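/- Let $D\subseteq\mathbb R^2$ be a domain (a nonempty connected open set) of the $(t,x)$-plane. For a smooth function $f=f(t,x)$ on $D$ and a smooth function $\lambda=\lambda(t)$ on the projection of $D$ to the $t$-axis such that \[ f_{xxx}=0,\qquad \lambda_t=f_{xx}\lambda,\qquad f\lambda\neq0\quad\text{everywhere on } D, \] let $\mathcal P_{f,\lambda}$ denote the equation over $D$ \[ v_t+\frac1{2\lambda}v_x^{2}+f\,v_{xx}-f_x v_x=0 \] for an unknown function $v=v(t,x)$. Let $\mathcal P^1$ be the set of those equations $\mathcal P_{f,\lambda}$ for which $f$ is constant on $D$, and $\mathcal P^2$ the set of those for which $f$ is not constant on $D$. A point transformation is a smooth map $\varphi=(T,X,V)\colon U\to\mathbb R^3$, $\tilde t=T(t,x,v)$, $\tilde x=X(t,x,v)$, $\tilde v=V(t,x,v)$, on an open set $U\subseteq\mathbb R^3$ with $\partial(T,X,V)/\partial(t,x,v)\neq0$ on $U$. It maps the equation $\mathcal P_{f,\lambda}$ over $D$ to the equation $\mathcal P_{\tilde f,\tilde\lambda}$ over $\tilde D$ if $D$ and $\tilde D$ are the projections of $U$ and of $\varphi(U)$ to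 the first two coordinates, and if, whenever $\varphi$ takes the graph (contained in $U$) of a smooth function $v$ on an open set $\Omega$ onto the graph of a smooth function $\tilde v$ on an open set $\tilde\Omega$, the function $v$ is a solution of $\mathcal P_{f,\lambda}$ on $\Omega$ if and only if $\tilde v$ is a solution of $\mathcal P_{\tilde f,\tilde\lambda}$ on $\tilde\Omega$. Then no point transformation maps an equation from $\mathcal P^1$ to an equation from $\mathcal P^2$, and none maps an equation from $\mathcal P^2$ to an equation from $\mathcal P^1$. -/

import Mathlib

open scoped ContDiff

namespace PotentialBurgers

/-- The partial derivative with respect to the first variable `t` of a function of `(t, x)`. -/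
noncomputable def dt (w : ℝ × ℝ → ℝ) : ℝ × ℝ → ℝ :=
  fun p => deriv (fun s => w (s, p.2)) p.1

/-- The partial derivative with respect to the second variable `x` of a function of `(t, x)`. -/
noncomputable def dx (w : ℝ × ℝ → ℝ) : ℝ × ℝ → ℝ :=
  fun p => deriv (fun y => w (p.1, y)) p.2

/-- The potential equation
`v_t + v_x ^ 2 / (2 * lam) + f * v_xx - f_x * v_x = 0`
over a domain `D` of the `(t, x)`-plane, given by its arbitrary element `(f, lam)`: a smooth
function `f = f(t, x)` on `D` and a smooth function `lam = lam(t)` on the projection of `D`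
to the `t`-axis such that `f_xxx = 0`, `lam_t = f_xx * lam` and `f * lam ≠ 0` on `D`. -/
structure PotEq where
  D : Set (ℝ × ℝ)
  f : ℝ × ℝ → ℝ
  lam : ℝ → ℝ
  isOpen_D : IsOpen D
  isConnected_D : IsConnected D
  smooth_f : ContDiffOn ℝ ∞ f D
  smooth_lam : ContDiffOn ℝ ∞ lam (Prod.fst '' D)
  f_xxx : ∀ p ∈ D, dx (dx (dx f)) p = 0
  lam_t : ∀ p ∈ D, deriv lam p.1 = dx (dx f) p * lam p.1
  ne_zero : ∀ p ∈ D, f p * lam p.1 ≠ 0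

/-- `v` is a (smooth) solution of the equation `E` on the set `Ω`, which is meant to be an open
subset of the domain of `E`. -/
def PotEq.IsSolutionOn (E : PotEq) (v : ℝ × ℝ → ℝ) (Ω : Set (ℝ × ℝ)) : Prop :=
  ContDiffOn ℝ ∞ v Ω ∧
    ∀ p ∈ Ω, dt v p + 1 / (2 * E.lam p.1) * dx v p ^ 2 + E.f p * dx (dx v) p
      - dx E.f p * dx v p = 0

/-- `f` is constant on the domain of the equation. -/
def PotEq.FConst (E : PotEq) : Prop := ∃ c : ℝ, ∀ p ∈ E.D, E.f p = c

/-- The subclass of the potential equations with constant `f`. -/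
def P1 : Set PotEq := {E | E.FConst}

/-- The subclass of the potential equations with nonconstant `f` (and `f_xxx = 0`). -/
def P2 : Set PotEq := {E | ¬ E.FConst}

/-- A (local) point transformation `t' = T(t, x, v)`, `x' = X(t, x, v)`, `v' = V(t, x, v)` in the
space of `(t, x, v)`: the components are smooth functions on an open set `dom`, and the Jacobian
`∂(T, X, V) / ∂(t, x, v)` does not vanish there. -/
structure PointTransformation where
  dom : Set (ℝ × ℝ × ℝ)
  T : ℝ × ℝ × ℝ → ℝ
  X : ℝ × ℝ × ℝ → ℝ
  V : ℝ × ℝ × ℝ → ℝ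
  isOpen_dom : IsOpen dom
  smooth_T : ContDiffOn ℝ ∞ T dom
  smooth_X : ContDiffOn ℝ ∞ X dom
  smooth_V : ContDiffOn ℝ ∞ V dom
  jacobian_ne_zero : ∀ q ∈ dom, (fderiv ℝ (fun r => (T r, X r, V r)) q).det ≠ 0

/-- The map of the `(t, x, v)`-space underlying a point transformation. -/
def PointTransformation.map (φ : PointTransformation) : ℝ × ℝ × ℝ → ℝ × ℝ × ℝ :=
  fun q => (φ.T q, φ.X q, φ.V q)

/-- The projection `(t, x, v) ↦ (t, x)`. -/
def proj : ℝ × ℝ × ℝ → ℝ × ℝ := fun q => (q.1, q.2.1)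

/-- The graph over `Ω` of a function `v = v(t, x)`. -/
def graph (v : ℝ × ℝ → ℝ) (Ω : Set (ℝ × ℝ)) : Set (ℝ × ℝ × ℝ) :=
  (fun p : ℝ × ℝ => (p.1, p.2, v p)) '' Ω

/-- The point transformation `φ` maps the equation `E` to the equation `E'`:
the domain and the image of `φ` lie exactly over the domains of `E` and of `E'`, and whenever `φ`
transforms the graph of a smooth function `v` over an open set to the graph of a smooth function
`v'` over an open set, `v` is a solution of `E` if and only if `v'` is a solution of `E'`. -/
def PointTransformation.MapsTo (φ : PointTransformation) (E E' : PotEq) : Prop :=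
  proj '' φ.dom = E.D ∧ proj '' (φ.map '' φ.dom) = E'.D ∧
    ∀ (Ω Ω' : Set (ℝ × ℝ)) (v v' : ℝ × ℝ → ℝ), IsOpen Ω → IsOpen Ω' →
      ContDiffOn ℝ ∞ v Ω → ContDiffOn ℝ ∞ v' Ω' →
      graph v Ω ⊆ φ.dom → φ.map '' graph v Ω = graph v' Ω' →
      (E.IsSolutionOn v Ω ↔ E'.IsSolutionOn v' Ω')

end PotentialBurgers

/-!
Let `ψ = (T, X, V)` be a point transformation that takes solutions of an equation `E` with constant
`f = c`, hence constant `λ = l`, to solutions of an equation `E'` with coefficients `f'`, `λ'`. It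
is shown that `f'` is locally constant. Both claims follow: a transformation from the first class to
the second is such a `ψ`, and a transformation from the second class to the first has local inverses
of this kind (`MapsTo.exists_inverse`). Only solutions of `E` have to be produced, and `E` has many
explicit ones: the linear functions `v₀ + k (x - x₀) - k² (t - t₀) / (2 l)`, and their perturbations
by `2 l c log (1 + Z)` with `Z` a heat polynomial in a moving frame (`hopfCole`). By the inverse
function theorem such a graph is mapped to a local graph for all but finitely many slopes `k`
(`exists_localImage`, `eventually_jac_ne_zero`).

If two solutions with equal values at a point differ by `m Z + o(Z)`, their images differ by
`g (Z ∘ Ψ) + o(Z ∘ Ψ)` with `g ≠ 0`, where `Ψ` is the inverse of `(t, x) ↦ (T, X)` along the graph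
of the second solution (`IsLocalImage.exists_sub_isLittleO`). With the quartic heat polynomial the
two images have the same first derivatives, so `E'` forces equal second `x`-derivatives, and this
means `T_x + k T_v = 0`; as `k` varies, `T = T(t)` (`pd_T_eq_zero`). With the quadratic heat
polynomial the same comparison gives `f' T_t = c (X_x + k X_v)²`, so `X = X(t, x)` and
`f' T_t = c X_x²` (`pd_X_eq_zero`).

For the linear solutions the equation for the image is then a polynomial in `k`, whose coefficients
are three differential equations for `V` (`determining_equations`) with coefficients
`M = 1 / (λ' f')` and `B` depending on `(t, x)` only. Their compatibility conditions are
`M_x V_v³ = 0` and `M_t V_v³ = 0` (`pd_pullbackM_eq_zero`), so `λ' f'` is locally constant. From its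
`x`-derivative, `f'_x = 0`; then `f'_xx = 0`, so `λ'` is constant by `λ'_t = f'_xx λ'`, and finally
`f'_t = 0`.
-/

namespace PotentialBurgers

open Filter Topology Asymptotics

/-! ### Directional derivatives of smooth functions -/

section Directional

variable {E : Type*} [NormedAddCommGroup E] [NormedSpace ℝ E]

/-- The derivative of `F` in the constant direction `e`, as a function of the point. -/
noncomputable def pd (e : E) (F : E → ℝ) : E → ℝ := fun q => fderiv ℝ F q e

theorem contDiffOn_pd {U : Set E} (hU : IsOpen U) {F : E → ℝ} (hF : ContDiffOn ℝ ∞ F U) (e : E) :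
    ContDiffOn ℝ ∞ (pd e F) U :=
  (hF.fderiv_of_isOpen hU (m := ∞) (by simp)).clm_apply contDiffOn_const

theorem differentiableAt_of_contDiffOn {F : Type*} [NormedAddCommGroup F] [NormedSpace ℝ F]
    {U : Set E} (hU : IsOpen U) {f : E → F} (hf : ContDiffOn ℝ ∞ f U) {q : E} (hq : q ∈ U) :
    DifferentiableAt ℝ f q :=
  (hf.contDiffAt (hU.mem_nhds hq)).differentiableAt (by simp)

theorem hasDerivAt_comp_pd {F : E → ℝ} {γ : ℝ → E} {γ' : E} {s : ℝ}
    (hF : DifferentiableAt ℝ F (γ s)) (hγ : HasDerivAt γ γ' s) :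
    HasDerivAt (fun r => F (γ r)) (pd γ' F (γ s)) s :=
  hF.hasFDerivAt.comp_hasDerivAt s hγ

theorem hasDerivAt_line (q e : E) (s : ℝ) : HasDerivAt (fun r : ℝ => q + r • e) e s := by
  simpa using ((hasDerivAt_id s).smul_const e).const_add q

theorem hasDerivAt_pd {U : Set E} (hU : IsOpen U) {F : E → ℝ} (hF : ContDiffOn ℝ ∞ F U)
    {q : E} (hq : q ∈ U) (e : E) :
    HasDerivAt (fun s : ℝ => F (q + s • e)) (pd e F q) 0 := by
  have := hasDerivAt_comp_pd (F := F) (γ := fun r : ℝ => q + r • e) (s := 0)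
    (by simpa using differentiableAt_of_contDiffOn hU hF hq) (hasDerivAt_line q e 0)
  simpa using this

theorem eventually_line_mem {U : Set E} (hU : IsOpen U) {q : E} (hq : q ∈ U) (e : E) :
    ∀ᶠ s : ℝ in 𝓝 0, q + s • e ∈ U := by
  have : ContinuousAt (fun s : ℝ => q + s • e) 0 := by fun_prop
  exact this.eventually_mem (hU.mem_nhds (by simpa using hq))

/-- An identity that holds on an open set may be differentiated in any direction. -/
theorem eq_zero_of_hasDerivAt_line {U : Set E} (hU : IsOpen U) {q e : E} (hq : q ∈ U)
    {R : E → ℝ} (hR : ∀ r ∈ U, R r = 0) {d : ℝ}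
    (hd : HasDerivAt (fun s : ℝ => R (q + s • e)) d 0) : d = 0 := by
  have h0 : HasDerivAt (fun s : ℝ => R (q + s • e)) 0 0 := by
    refine (hasDerivAt_const (0 : ℝ) (0 : ℝ)).congr_of_eventuallyEq ?_
    filter_upwards [eventually_line_mem hU hq e] with s hs using hR _ hs
  exact hd.unique h0

theorem pd_congr {U : Set E} (hU : IsOpen U) {F G : E → ℝ} (h : ∀ r ∈ U, F r = G r)
    {q : E} (hq : q ∈ U) (e : E) : pd e F q = pd e G q := by
  have : F =ᶠ[𝓝 q] G := by filter_upwards [hU.mem_nhds hq] with r hr using h r hr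
  simp [pd, this.fderiv_eq]

theorem pd_eq_zero {U : Set E} (hU : IsOpen U) {F : E → ℝ} (h : ∀ r ∈ U, F r = 0)
    {q : E} (hq : q ∈ U) (e : E) : pd e F q = 0 := by
  rw [pd_congr hU (G := fun _ => 0) h hq]
  simp [pd]

theorem pd_comm {U : Set E} (hU : IsOpen U) {F : E → ℝ} (hF : ContDiffOn ℝ ∞ F U)
    {q : E} (hq : q ∈ U) (e e' : E) : pd e (pd e' F) q = pd e' (pd e F) q := by
  have hd : DifferentiableAt ℝ (fderiv ℝ F) q :=
    differentiableAt_of_contDiffOn hU (hF.fderiv_of_isOpen hU (m := ∞) (by simp)) hq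
  have hs : IsSymmSndFDerivAt ℝ F q :=
    (hF.contDiffAt (hU.mem_nhds hq)).isSymmSndFDerivAt (by
      rw [minSmoothness_of_isRCLikeNormedField]; exact WithTop.coe_le_coe.2 (le_top : (2 : ℕ∞) ≤ ⊤))
  have h (a b : E) : pd a (pd b F) q = fderiv ℝ (fderiv ℝ F) q a b := by
    unfold pd
    rw [fderiv_clm_apply hd (differentiableAt_const _)]
    simp
  rw [h, h]
  exact hs e e'

theorem eq_of_pd_eq_zero {U : Set E} (hU : IsOpen U) {F : E → ℝ} (hF : ContDiffOn ℝ ∞ F U)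
    {W : Set E} (hW : Convex ℝ W) (hWU : W ⊆ U) {q r : E} (hq : q ∈ W) (hr : r ∈ W)
    (h : ∀ z ∈ W, pd (r - q) F z = 0) : F r = F q := by
  obtain ⟨z, hz, hz'⟩ := domain_mvt (f := F) (f' := fun z => fderiv ℝ F z) (s := W)
    (fun z hz => (differentiableAt_of_contDiffOn hU hF (hWU hz)).hasFDerivAt.hasFDerivWithinAt)
    hW hq hr
  have : F r - F q = pd (r - q) F z := hz'
  rw [h z (hW.segment_subset hq hr hz)] at this
  linarith

/-- The inverse function theorem in finite dimension, with an inverse that is smooth on all of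
its domain. -/
theorem exists_smooth_localInverse [FiniteDimensional ℝ E] {U : Set E} (hU : IsOpen U)
    {f : E → E} (hf : ContDiffOn ℝ ∞ f U) {a : E} (ha : a ∈ U)
    (hdet : (fderiv ℝ f a).det ≠ 0) :
    ∃ e : OpenPartialHomeomorph E E, a ∈ e.source ∧ e.source ⊆ U ∧ (∀ x, e x = f x) ∧
      ContDiffOn ℝ ∞ e.symm e.target := by
  have : CompleteSpace E := FiniteDimensional.complete ℝ E
  have hcont : ContinuousOn (fun x => (fderiv ℝ f x).det) U :=
    ContinuousLinearMap.continuous_det.comp_continuousOn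
      (hf.continuousOn_fderiv_of_isOpen hU (by simp))
  have hU' : IsOpen (U ∩ (fun x => (fderiv ℝ f x).det) ⁻¹' {0}ᶜ) :=
    hcont.isOpen_inter_preimage hU isOpen_compl_singleton
  have hfa : ∀ x ∈ U, ∀ h : (fderiv ℝ f x).det ≠ 0,
      HasFDerivAt f ((fderiv ℝ f x).toContinuousLinearEquivOfDetNeZero h : E →L[ℝ] E) x := by
    intro x hx h
    rw [ContinuousLinearMap.coe_toContinuousLinearEquivOfDetNeZero]
    exact (differentiableAt_of_contDiffOn hU hf hx).hasFDerivAt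
  have hca := hf.contDiffAt (hU.mem_nhds ha)
  set e₀ := hca.toOpenPartialHomeomorph f (hfa a ha hdet) (by simp) with he₀
  refine ⟨e₀.restrOpen _ hU', ?_, ?_, fun x => rfl, ?_⟩
  · exact ⟨hca.mem_toOpenPartialHomeomorph_source (hfa a ha hdet) (by simp), ha, hdet⟩
  · intro x hx
    exact hx.2.1
  · intro y hy
    have hys := (e₀.restrOpen _ hU').map_target hy
    refine ContDiffAt.contDiffWithinAt ?_
    exact (e₀.restrOpen _ hU').contDiffAt_symm hy (hfa _ hys.2.1 hys.2.2)
      (hf.contDiffAt (hU.mem_nhds hys.2.1))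

end Directional

/-! ### Auxiliary facts about real functions -/

/-- A real polynomial of degree at most two with infinitely many roots vanishes. -/
theorem coeffs_eq_zero_of_frequently {a b c : ℝ}
    (h : ∃ᶠ k : ℝ in cofinite, a + b * k + c * k ^ 2 = 0) : a = 0 ∧ b = 0 ∧ c = 0 := by
  have h' : {k : ℝ | a + b * k + c * k ^ 2 = 0}.Infinite :=
    Filter.frequently_cofinite_iff_infinite.1 h
  have hp : (Polynomial.C a + Polynomial.C b * Polynomial.X
      + Polynomial.C c * Polynomial.X ^ 2 : Polynomial ℝ) = 0 := by
    refine Polynomial.eq_zero_of_infinite_isRoot _ (h'.mono fun k hk => ?_)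
    simpa [Polynomial.IsRoot] using hk
  refine ⟨?_, ?_, ?_⟩
  · simpa using congrArg (fun p => Polynomial.coeff p 0) hp
  · simpa [Polynomial.coeff_X, Polynomial.coeff_C] using
      congrArg (fun p => Polynomial.coeff p 1) hp
  · simpa [Polynomial.coeff_X, Polynomial.coeff_C] using
      congrArg (fun p => Polynomial.coeff p 2) hp

/-- If `F` vanishes at `a` together with its derivative, the limit of `F s / (s - a) ^ 2` is half
of the second derivative. -/
theorem deriv_deriv_eq_of_tendsto {F : ℝ → ℝ} {a L : ℝ} (hF : ∀ᶠ s in 𝓝 a, DifferentiableAt ℝ F s)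
    (hF' : DifferentiableAt ℝ (deriv F) a) (h0 : F a = 0) (h1 : deriv F a = 0)
    (hL : Tendsto (fun s => F s / (s - a) ^ 2) (𝓝[≠] a) (𝓝 L)) : deriv (deriv F) a = 2 * L := by
  have hslope : Tendsto (fun s => deriv F s / (2 * (s - a))) (𝓝[≠] a)
      (𝓝 (deriv (deriv F) a / 2)) := by
    have := (hasDerivAt_iff_tendsto_slope.1 hF'.hasDerivAt).div_const 2
    refine this.congr' ?_
    filter_upwards with s
    rw [slope_def_field, h1, sub_zero, div_div, mul_comm]
  have hlim : Tendsto (fun s => F s / (s - a) ^ 2) (𝓝[≠] a) (𝓝 (deriv (deriv F) a / 2)) := by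
    refine HasDerivAt.lhopital_zero_nhdsNE (f' := deriv F) (g' := fun s => 2 * (s - a)) ?_ ?_ ?_
      ?_ ?_ hslope
    · exact (hF.filter_mono nhdsWithin_le_nhds).mono fun s hs => hs.hasDerivAt
    · filter_upwards with s
      simpa using ((hasDerivAt_id s).sub_const a).fun_pow 2
    · filter_upwards [self_mem_nhdsWithin] with s hs
      exact mul_ne_zero two_ne_zero (sub_ne_zero.2 hs)
    · have : ContinuousAt F a := hF.self_of_nhds.continuousAt
      simpa [ContinuousAt, h0] using this.tendsto.mono_left nhdsWithin_le_nhds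
    · have : ContinuousAt (fun s : ℝ => (s - a) ^ 2) a := by fun_prop
      simpa [ContinuousAt] using this.tendsto.mono_left nhdsWithin_le_nhds
  have := tendsto_nhds_unique hlim hL
  linarith

/-! ### Graphs and their images under a point transformation -/

/-- The parametrization `(t, x) ↦ (t, x, v(t, x))` of the graph of `v`. -/
def lift (v : ℝ × ℝ → ℝ) (p : ℝ × ℝ) : ℝ × ℝ × ℝ := (p.1, p.2, v p)

namespace PointTransformation

variable (ψ : PointTransformation)

/-- The first two components `(T, X)` of a point transformation. -/
def base (q : ℝ × ℝ × ℝ) : ℝ × ℝ := (ψ.T q, ψ.X q)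

/-- The one-sided version of `PointTransformation.MapsTo`: `ψ` is defined over (a part of) the
domain of `E`, takes its values over the domain of `E'`, and transforms solutions of `E` to
solutions of `E'`. -/
def Carries (E E' : PotEq) : Prop :=
  (∀ q ∈ ψ.dom, proj q ∈ E.D) ∧ (∀ q ∈ ψ.dom, ψ.base q ∈ E'.D) ∧
    ∀ (Ω Ω' : Set (ℝ × ℝ)) (v v' : ℝ × ℝ → ℝ), IsOpen Ω → IsOpen Ω' →
      ContDiffOn ℝ ∞ v' Ω' → graph v Ω ⊆ ψ.dom → ψ.map '' graph v Ω = graph v' Ω' →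
      E.IsSolutionOn v Ω → E'.IsSolutionOn v' Ω'

variable {ψ}

theorem contDiffOn_base : ContDiffOn ℝ ∞ ψ.base ψ.dom := ψ.smooth_T.prodMk ψ.smooth_X

theorem contDiffOn_map : ContDiffOn ℝ ∞ ψ.map ψ.dom :=
  ψ.smooth_T.prodMk (ψ.smooth_X.prodMk ψ.smooth_V)

theorem fderiv_map_apply {q : ℝ × ℝ × ℝ} (hq : q ∈ ψ.dom) (e : ℝ × ℝ × ℝ) :
    fderiv ℝ ψ.map q e = (pd e ψ.T q, pd e ψ.X q, pd e ψ.V q) := by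
  have hT := (differentiableAt_of_contDiffOn ψ.isOpen_dom ψ.smooth_T hq).hasFDerivAt
  have hX := (differentiableAt_of_contDiffOn ψ.isOpen_dom ψ.smooth_X hq).hasFDerivAt
  have hV := (differentiableAt_of_contDiffOn ψ.isOpen_dom ψ.smooth_V hq).hasFDerivAt
  have h : HasFDerivAt ψ.map _ q := hT.prodMk (hX.prodMk hV)
  rw [h.fderiv]
  rfl

theorem exists_direction {q : ℝ × ℝ × ℝ} (hq : q ∈ ψ.dom) (α β γ : ℝ) :
    ∃ e, pd e ψ.T q = α ∧ pd e ψ.X q = β ∧ pd e ψ.V q = γ := by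
  obtain ⟨e, he⟩ := (ContinuousLinearMap.toContinuousLinearEquivOfDetNeZero _
    (ψ.jacobian_ne_zero q hq)).surjective (α, β, γ)
  rw [ContinuousLinearMap.toContinuousLinearEquivOfDetNeZero_apply] at he
  have := (fderiv_map_apply hq e).symm.trans he
  simp only [Prod.mk.injEq] at this
  exact ⟨e, this⟩

theorem direction_eq_zero {q : ℝ × ℝ × ℝ} (hq : q ∈ ψ.dom) {e : ℝ × ℝ × ℝ}
    (hT : pd e ψ.T q = 0) (hX : pd e ψ.X q = 0) (hV : pd e ψ.V q = 0) : e = 0 := by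
  apply (ContinuousLinearMap.toContinuousLinearEquivOfDetNeZero _
    (ψ.jacobian_ne_zero q hq)).injective
  rw [ContinuousLinearMap.toContinuousLinearEquivOfDetNeZero_apply, map_zero]
  refine (fderiv_map_apply hq e).trans ?_
  rw [hT, hX, hV]
  rfl

end PointTransformation

theorem contDiffOn_lift {v : ℝ × ℝ → ℝ} {Ω : Set (ℝ × ℝ)} (hv : ContDiffOn ℝ ∞ v Ω) :
    ContDiffOn ℝ ∞ (lift v) Ω :=
  contDiffOn_fst.prodMk (contDiffOn_snd.prodMk hv)

theorem hasFDerivAt_lift {v : ℝ × ℝ → ℝ} {p : ℝ × ℝ} (hv : DifferentiableAt ℝ v p) :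
    HasFDerivAt (lift v) ((ContinuousLinearMap.fst ℝ ℝ ℝ).prod
      ((ContinuousLinearMap.snd ℝ ℝ ℝ).prod (fderiv ℝ v p))) p :=
  hasFDerivAt_fst.prodMk (hasFDerivAt_snd.prodMk hv.hasFDerivAt)

theorem pd_comp_lift {v : ℝ × ℝ → ℝ} {p : ℝ × ℝ} (hv : DifferentiableAt ℝ v p)
    {F : ℝ × ℝ × ℝ → ℝ} (hF : DifferentiableAt ℝ F (lift v p)) (e : ℝ × ℝ) :
    pd e (fun r => F (lift v r)) p = pd (e.1, e.2, pd e v p) F (lift v p) := by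
  have h := hF.hasFDerivAt.comp p (hasFDerivAt_lift hv)
  have h' : fderiv ℝ (fun r => F (lift v r)) p = _ := h.fderiv
  simp [pd, h']

theorem det_prod_eq (A : ℝ × ℝ →L[ℝ] ℝ × ℝ) :
    A.det = (A (1, 0)).1 * (A (0, 1)).2 - (A (0, 1)).1 * (A (1, 0)).2 := by
  rw [ContinuousLinearMap.det, ← LinearMap.det_toMatrix (Module.Basis.finTwoProd ℝ),
    Matrix.det_fin_two]
  simp [LinearMap.toMatrix_apply]

theorem PotEq.IsSolutionOn.mono {E : PotEq} {v : ℝ × ℝ → ℝ} {Ω Ω₀ : Set (ℝ × ℝ)}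
    (h : E.IsSolutionOn v Ω) (hs : Ω₀ ⊆ Ω) : E.IsSolutionOn v Ω₀ :=
  ⟨h.1.mono hs, fun p hp => h.2 p (hs hp)⟩

/-- The Jacobian determinant of `(t, x) ↦ (T, X)(t, x, v(t, x))` at a point where the graph of `v`
passes through `q` with `v_t = a` and `v_x = b`. -/
noncomputable def PointTransformation.jac (ψ : PointTransformation) (q : ℝ × ℝ × ℝ) (a b : ℝ) : ℝ :=
  pd (1, 0, a) ψ.T q * pd (0, 1, b) ψ.X q - pd (0, 1, b) ψ.T q * pd (1, 0, a) ψ.X q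

/-- Near the point of the graph of `v` over `p₀`, the transformation `ψ` takes the graph of `v` to
the graph over `Ω'` of the function `v'`, and `Ψ` is the local inverse of
`(t, x) ↦ (T, X)(t, x, v(t, x))`. -/
structure IsLocalImage (ψ : PointTransformation) (v : ℝ × ℝ → ℝ) (p₀ : ℝ × ℝ)
    (Ω' : Set (ℝ × ℝ)) (v' : ℝ × ℝ → ℝ) (Ψ : ℝ × ℝ → ℝ × ℝ) : Prop where
  isOpen : IsOpen Ω'
  mem : ψ.base (lift v p₀) ∈ Ω'
  smooth : ContDiffOn ℝ ∞ v' Ω'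
  smooth_inv : ContDiffOn ℝ ∞ Ψ Ω'
  inv_base : Ψ (ψ.base (lift v p₀)) = p₀
  lift_mem : ∀ p' ∈ Ω', lift v (Ψ p') ∈ ψ.dom
  base_inv : ∀ p' ∈ Ω', ψ.base (lift v (Ψ p')) = p'
  V_inv : ∀ p' ∈ Ω', ψ.V (lift v (Ψ p')) = v' p'
  eventually_mem : ∀ᶠ p in 𝓝 p₀, ψ.base (lift v p) ∈ Ω'
  eventually_eq : ∀ᶠ p in 𝓝 p₀, v' (ψ.base (lift v p)) = ψ.V (lift v p)

theorem PointTransformation.Carries.exists_localImage {ψ : PointTransformation} {E E' : PotEq}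
    (h : ψ.Carries E E') {v : ℝ × ℝ → ℝ} {Ω : Set (ℝ × ℝ)} (hΩ : IsOpen Ω)
    (hv : E.IsSolutionOn v Ω) {p₀ : ℝ × ℝ} (hp₀ : p₀ ∈ Ω) (hq : lift v p₀ ∈ ψ.dom)
    (hJ : ψ.jac (lift v p₀) (pd (1, 0) v p₀) (pd (0, 1) v p₀) ≠ 0) :
    ∃ Ω' v' Ψ, IsLocalImage ψ v p₀ Ω' v' Ψ ∧ E'.IsSolutionOn v' Ω' := by
  have hU : IsOpen (Ω ∩ lift v ⁻¹' ψ.dom) :=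
    (contDiffOn_lift hv.1).continuousOn.isOpen_inter_preimage hΩ ψ.isOpen_dom
  have hlift : ContDiffOn ℝ ∞ (lift v) (Ω ∩ lift v ⁻¹' ψ.dom) :=
    (contDiffOn_lift hv.1).mono Set.inter_subset_left
  have hΦ : ContDiffOn ℝ ∞ (fun p => ψ.base (lift v p)) (Ω ∩ lift v ⁻¹' ψ.dom) :=
    ψ.contDiffOn_base.comp hlift fun p hp => hp.2
  have hdet : (fderiv ℝ (fun p => ψ.base (lift v p)) p₀).det ≠ 0 := by
    have hvd := differentiableAt_of_contDiffOn hΩ hv.1 hp₀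
    have hT := differentiableAt_of_contDiffOn ψ.isOpen_dom ψ.smooth_T hq
    have hX := differentiableAt_of_contDiffOn ψ.isOpen_dom ψ.smooth_X hq
    have hA (e : ℝ × ℝ) : fderiv ℝ (fun p => ψ.base (lift v p)) p₀ e =
        (pd e (fun p => ψ.T (lift v p)) p₀, pd e (fun p => ψ.X (lift v p)) p₀) := by
      have h1 : DifferentiableAt ℝ (fun p => ψ.T (lift v p)) p₀ :=
        hT.comp p₀ (hasFDerivAt_lift hvd).differentiableAt
      have h2 : DifferentiableAt ℝ (fun p => ψ.X (lift v p)) p₀ :=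
        hX.comp p₀ (hasFDerivAt_lift hvd).differentiableAt
      have h3 : fderiv ℝ (fun p => ψ.base (lift v p)) p₀ = _ :=
        (h1.hasFDerivAt.prodMk h2.hasFDerivAt).fderiv
      rw [h3]
      rfl
    rw [det_prod_eq, hA, hA, pd_comp_lift hvd hT, pd_comp_lift hvd hX, pd_comp_lift hvd hT,
      pd_comp_lift hvd hX]
    exact hJ
  obtain ⟨e, hes, heU, hef, hsymm⟩ := exists_smooth_localInverse hU hΦ ⟨hp₀, hq⟩ hdet
  have hsrc : ∀ p' ∈ e.target, e.symm p' ∈ Ω ∩ lift v ⁻¹' ψ.dom :=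
    fun p' hp' => heU (e.map_target hp')
  have himg : IsLocalImage ψ v p₀ e.target (fun p' => ψ.V (lift v (e.symm p'))) e.symm :=
    { isOpen := e.open_target
      mem := by
        rw [← hef p₀]
        exact e.map_source hes
      smooth := ψ.smooth_V.comp (hlift.comp hsymm hsrc) fun p' hp' => (hsrc p' hp').2
      smooth_inv := hsymm
      inv_base := by
        rw [← hef p₀]
        exact e.left_inv hes
      lift_mem := fun p' hp' => (hsrc p' hp').2
      base_inv := fun p' hp' => by
        rw [← hef]
        exact e.right_inv hp'
      V_inv := fun p' _ => rfl
      eventually_mem := by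
        filter_upwards [e.open_source.mem_nhds hes] with p hp
        rw [← hef p]
        exact e.map_source hp
      eventually_eq := by
        filter_upwards [e.open_source.mem_nhds hes] with p hp
        rw [← hef p, e.left_inv hp] }
  refine ⟨_, _, _, himg, ?_⟩
  refine h.2.2 e.source e.target v _ e.open_source e.open_target himg.smooth ?_ ?_
    (hv.mono fun p hp => (heU hp).1)
  · rintro _ ⟨p, hp, rfl⟩
    exact (heU hp).2
  · ext r
    constructor
    · rintro ⟨_, ⟨p, hp, rfl⟩, rfl⟩
      refine ⟨e p, e.map_source hp, ?_⟩
      change ((e p).1, (e p).2, ψ.V (lift v (e.symm (e p)))) = ψ.map (lift v p)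
      rw [e.left_inv hp, hef]
      rfl
    · rintro ⟨p', hp', rfl⟩
      refine ⟨_, ⟨e.symm p', e.map_target hp', rfl⟩, ?_⟩
      change ψ.map (lift v (e.symm p')) = (p'.1, p'.2, ψ.V (lift v (e.symm p')))
      have : ψ.base (lift v (e.symm p')) = p' := himg.base_inv p' hp'
      have h1 : ψ.T (lift v (e.symm p')) = p'.1 := congrArg (fun z : ℝ × ℝ => z.1) this
      have h2 : ψ.X (lift v (e.symm p')) = p'.2 := congrArg (fun z : ℝ × ℝ => z.2) this
      simp only [PointTransformation.map, h1, h2]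

/-- A point transformation restricts, near every point, to a bijection, and the inverse of the
restriction transforms solutions in the opposite direction. -/
theorem PointTransformation.MapsTo.exists_inverse {φ : PointTransformation} {E E' : PotEq}
    (h : φ.MapsTo E E') {q : ℝ × ℝ × ℝ} (hq : q ∈ φ.dom) :
    ∃ ψ : PointTransformation, φ.map q ∈ ψ.dom ∧ ψ.map (φ.map q) = q ∧ ψ.Carries E' E := by
  obtain ⟨e, hes, heU, hef, hsymm⟩ := exists_smooth_localInverse φ.isOpen_dom
    φ.contDiffOn_map hq (φ.jacobian_ne_zero q hq)
  have hjac : ∀ r ∈ e.target, (fderiv ℝ e.symm r).det ≠ 0 := by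
    intro r hr
    have h1 : DifferentiableAt ℝ e.symm r := differentiableAt_of_contDiffOn e.open_target hsymm hr
    have h2 : DifferentiableAt ℝ φ.map (e.symm r) :=
      differentiableAt_of_contDiffOn φ.isOpen_dom φ.contDiffOn_map (heU (e.map_target hr))
    have h3 : HasFDerivAt (fun z => φ.map (e.symm z))
        ((fderiv ℝ φ.map (e.symm r)).comp (fderiv ℝ e.symm r)) r :=
      h2.hasFDerivAt.comp r h1.hasFDerivAt
    have h4 : HasFDerivAt (fun z => φ.map (e.symm z)) (ContinuousLinearMap.id ℝ _) r := by
      refine (hasFDerivAt_id r).congr_of_eventuallyEq ?_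
      filter_upwards [e.open_target.mem_nhds hr] with z hz
      rw [← hef]
      exact e.right_inv hz
    have h5 := congrArg ContinuousLinearMap.det (h3.unique h4)
    intro h0
    have h6 : (fderiv ℝ φ.map (e.symm r)).det * (fderiv ℝ e.symm r).det = 1 := by
      simpa [ContinuousLinearMap.det, LinearMap.det_comp] using h5
    rw [h0, mul_zero] at h6
    exact zero_ne_one h6
  refine ⟨{ dom := e.target
            T := fun r => (e.symm r).1
            X := fun r => (e.symm r).2.1
            V := fun r => (e.symm r).2.2
            isOpen_dom := e.open_target
            smooth_T := contDiff_fst.comp_contDiffOn hsymm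
            smooth_X := (contDiff_fst.comp contDiff_snd).comp_contDiffOn hsymm
            smooth_V := (contDiff_snd.comp contDiff_snd).comp_contDiffOn hsymm
            jacobian_ne_zero := hjac }, ?_, ?_, ?_, ?_, ?_⟩
  · rw [← hef]
    exact e.map_source hes
  · change e.symm (φ.map q) = q
    rw [← hef]
    exact e.left_inv hes
  · intro r hr
    rw [← h.2.1]
    refine ⟨_, ⟨e.symm r, heU (e.map_target hr), rfl⟩, ?_⟩
    rw [← hef, e.right_inv hr]
  · intro r hr
    rw [← h.1]
    exact ⟨e.symm r, heU (e.map_target hr), rfl⟩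
  · intro Ω' Ω v' v hΩ' hΩ hv hgr himg hsol
    have hback : φ.map '' graph v Ω = graph v' Ω' := by
      have himg' : e.symm '' graph v' Ω' = graph v Ω := himg
      rw [← himg', Set.image_image]
      ext r
      constructor
      · rintro ⟨z, hz, rfl⟩
        have : φ.map (e.symm z) = z := by rw [← hef]; exact e.right_inv (hgr hz)
        simpa only [this] using hz
      · intro hz
        exact ⟨r, hz, by simpa only [hef] using e.right_inv (hgr hz)⟩
    have hsub : graph v Ω ⊆ φ.dom := by
      have himg' : e.symm '' graph v' Ω' = graph v Ω := himg
      rw [← himg']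
      rintro _ ⟨z, hz, rfl⟩
      exact heU (e.map_target (hgr hz))
    exact (h.2.2 Ω Ω' v v' hΩ hΩ' hv hsol.1 hsub hback).2 hsol

theorem PointTransformation.MapsTo.carries {φ : PointTransformation} {E E' : PotEq}
    (h : φ.MapsTo E E') : φ.Carries E E' := by
  refine ⟨fun q hq => h.1 ▸ ⟨q, hq, rfl⟩, fun q hq => h.2.1 ▸ ⟨_, ⟨q, hq, rfl⟩, rfl⟩, ?_⟩
  intro Ω Ω' v v' hΩ hΩ' hv' hgr himg hsol
  exact (h.2.2 Ω Ω' v v' hΩ hΩ' hsol.1 hv' hgr himg).1 hsol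

/-! ### Explicit solutions of the equation with constant coefficients -/

theorem hasDerivAt_slice_fst {w : ℝ × ℝ → ℝ} {p : ℝ × ℝ} (hw : DifferentiableAt ℝ w p) :
    HasDerivAt (fun s => w (s, p.2)) (pd (1, 0) w p) p.1 :=
  hasDerivAt_comp_pd (γ := fun s => (s, p.2)) hw ((hasDerivAt_id p.1).prodMk (hasDerivAt_const _ _))

theorem hasDerivAt_slice_snd {w : ℝ × ℝ → ℝ} {p : ℝ × ℝ} (hw : DifferentiableAt ℝ w p) :
    HasDerivAt (fun y => w (p.1, y)) (pd (0, 1) w p) p.2 :=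
  hasDerivAt_comp_pd (γ := fun y => (p.1, y)) hw ((hasDerivAt_const _ _).prodMk (hasDerivAt_id p.2))

theorem dt_eq_pd {w : ℝ × ℝ → ℝ} {p : ℝ × ℝ} (hw : DifferentiableAt ℝ w p) :
    dt w p = pd (1, 0) w p := (hasDerivAt_slice_fst hw).deriv

theorem dx_eq_pd {w : ℝ × ℝ → ℝ} {p : ℝ × ℝ} (hw : DifferentiableAt ℝ w p) :
    dx w p = pd (0, 1) w p := (hasDerivAt_slice_snd hw).deriv

theorem eventually_slice_mem {Ω : Set (ℝ × ℝ)} (hΩ : IsOpen Ω) {p : ℝ × ℝ} (hp : p ∈ Ω) :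
    ∀ᶠ y in 𝓝 p.2, (p.1, y) ∈ Ω := by
  have : ContinuousAt (fun y : ℝ => (p.1, y)) p.2 := by fun_prop
  exact this.eventually_mem (hΩ.mem_nhds hp)

theorem dx_dx_eq_pd {w : ℝ × ℝ → ℝ} {Ω : Set (ℝ × ℝ)} (hΩ : IsOpen Ω) (hw : ContDiffOn ℝ ∞ w Ω)
    {p : ℝ × ℝ} (hp : p ∈ Ω) : dx (dx w) p = pd (0, 1) (pd (0, 1) w) p := by
  rw [← dx_eq_pd (differentiableAt_of_contDiffOn hΩ (contDiffOn_pd hΩ hw _) hp)]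
  refine Filter.EventuallyEq.deriv_eq ?_
  filter_upwards [eventually_slice_mem hΩ hp] with y hy
  exact dx_eq_pd (differentiableAt_of_contDiffOn hΩ hw hy)

/-- An equation with constant `f` has constant coefficients. -/
theorem PotEq.FConst.exists_coeffs {E : PotEq} (h : E.FConst) :
    ∃ c l : ℝ, c ≠ 0 ∧ l ≠ 0 ∧ ∀ p ∈ E.D, E.f p = c ∧ dx E.f p = 0 ∧ E.lam p.1 = l := by
  obtain ⟨c, hc⟩ := h
  obtain ⟨p₀, hp₀⟩ := E.isConnected_D.nonempty
  have hf : ∀ p ∈ E.D, dx E.f p = 0 := by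
    intro p hp
    have : (fun y => E.f (p.1, y)) =ᶠ[𝓝 p.2] fun _ => c := by
      filter_upwards [eventually_slice_mem E.isOpen_D hp] with y hy using hc _ hy
    rw [dx, this.deriv_eq, deriv_const]
  have hff : ∀ p ∈ E.D, dx (dx E.f) p = 0 := by
    intro p hp
    have : (fun y => dx E.f (p.1, y)) =ᶠ[𝓝 p.2] fun _ => 0 := by
      filter_upwards [eventually_slice_mem E.isOpen_D hp] with y hy using hf _ hy
    rw [dx, this.deriv_eq, deriv_const]
  have hI : IsOpen (Prod.fst '' E.D) := isOpenMap_fst _ E.isOpen_D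
  have hlam : ∀ p ∈ E.D, E.lam p.1 = E.lam p₀.1 := by
    intro p hp
    refine hI.is_const_of_deriv_eq_zero
      (E.isConnected_D.isPreconnected.image _ continuous_fst.continuousOn)
      (E.smooth_lam.differentiableOn (by simp)) ?_ ⟨p, hp, rfl⟩ ⟨p₀, hp₀, rfl⟩
    rintro _ ⟨r, hr, rfl⟩
    rw [E.lam_t r hr, hff r hr, zero_mul]
    rfl
  have hne := E.ne_zero p₀ hp₀
  rw [hc p₀ hp₀] at hne
  exact ⟨c, E.lam p₀.1, left_ne_zero_of_mul hne, right_ne_zero_of_mul hne,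
    fun p hp => ⟨hc p hp, hf p hp, hlam p hp⟩⟩

/-- The function `v₀ + k (x - x₀) - k² (t - t₀) / (2 l) + 2 l c log (1 + Z)`: the Hopf–Cole
transform turns a solution `Z` of `Z_t + (k / l) Z_x + c Z_xx = 0` into a solution of
`v_t + v_x² / (2 l) + c v_xx = 0`. -/
noncomputable def hopfCole (c l k v₀ : ℝ) (p₀ : ℝ × ℝ) (Z : ℝ × ℝ → ℝ) (p : ℝ × ℝ) : ℝ :=
  v₀ + k * (p.2 - p₀.2) - k ^ 2 / (2 * l) * (p.1 - p₀.1) + 2 * l * c * Real.log (1 + Z p)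

/-- `Z` is a smooth solution on the whole plane of the heat equation with drift
`Z_t + (k / l) Z_x + c Z_xx = 0`, and its derivatives `Z_t`, `Z_x`, `Z_xx` are the given
functions. -/
structure IsHeat (c l k : ℝ) (Z Zt Zx Zxx : ℝ × ℝ → ℝ) : Prop where
  smooth : ContDiff ℝ ∞ Z
  t : ∀ p, HasDerivAt (fun s => Z (s, p.2)) (Zt p) p.1
  x : ∀ p, HasDerivAt (fun y => Z (p.1, y)) (Zx p) p.2
  xx : ∀ p, HasDerivAt (fun y => Zx (p.1, y)) (Zxx p) p.2
  eq : ∀ p, Zt p + k / l * Zx p + c * Zxx p = 0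

section

variable {c l k v₀ : ℝ} {p₀ : ℝ × ℝ} {Z Zt Zx Zxx : ℝ × ℝ → ℝ}

theorem isHeat_zero : IsHeat c l k (fun _ => 0) (fun _ => 0) (fun _ => 0) (fun _ => 0) where
  smooth := contDiff_const
  t := fun _ => hasDerivAt_const _ _
  x := fun _ => hasDerivAt_const _ _
  xx := fun _ => hasDerivAt_const _ _
  eq := fun _ => by ring

/-- The heat polynomial of degree two, in the frame moving with the drift. -/
noncomputable def heatQuadratic (c l k : ℝ) (p₀ p : ℝ × ℝ) : ℝ :=
  (p.2 - p₀.2 - k / l * (p.1 - p₀.1)) ^ 2 - 2 * c * (p.1 - p₀.1)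

/-- The heat polynomial of degree four, in the frame moving with the drift. -/
noncomputable def heatQuartic (c l k : ℝ) (p₀ p : ℝ × ℝ) : ℝ :=
  (p.2 - p₀.2 - k / l * (p.1 - p₀.1)) ^ 4
    - 12 * c * (p.1 - p₀.1) * (p.2 - p₀.2 - k / l * (p.1 - p₀.1)) ^ 2
    + 12 * c ^ 2 * (p.1 - p₀.1) ^ 2

theorem hasDerivAt_drift_t (p : ℝ × ℝ) :
    HasDerivAt (fun s => p.2 - p₀.2 - k / l * (s - p₀.1)) (-(k / l)) p.1 := by
  simpa using (((hasDerivAt_id p.1).sub_const p₀.1).const_mul (k / l)).const_sub (p.2 - p₀.2)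

theorem hasDerivAt_drift_x (p : ℝ × ℝ) :
    HasDerivAt (fun y => y - p₀.2 - k / l * (p.1 - p₀.1)) 1 p.2 :=
  ((hasDerivAt_id p.2).sub_const p₀.2).sub_const _

theorem isHeat_quadratic : IsHeat c l k (heatQuadratic c l k p₀)
    (fun p => -(2 * (k / l) * (p.2 - p₀.2 - k / l * (p.1 - p₀.1))) - 2 * c)
    (fun p => 2 * (p.2 - p₀.2 - k / l * (p.1 - p₀.1))) (fun _ => 2) where
  smooth := by unfold heatQuadratic; fun_prop
  t := fun p => by
    refine (((hasDerivAt_drift_t p).fun_pow 2).sub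
      (((hasDerivAt_id p.1).sub_const p₀.1).const_mul (2 * c))).congr_deriv ?_
    simp
    ring
  x := fun p => by
    refine (((hasDerivAt_drift_x (k := k) (l := l) (p₀ := p₀) p).fun_pow 2).sub_const
      (2 * c * (p.1 - p₀.1))).congr_deriv ?_
    simp
  xx := fun p => by
    refine ((hasDerivAt_drift_x p).const_mul 2).congr_deriv ?_
    ring
  eq := fun p => by ring

theorem isHeat_quartic : IsHeat c l k (heatQuartic c l k p₀)
    (fun p => -(k / l) * (4 * (p.2 - p₀.2 - k / l * (p.1 - p₀.1)) ^ 3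
        - 24 * c * (p.1 - p₀.1) * (p.2 - p₀.2 - k / l * (p.1 - p₀.1)))
      - 12 * c * (p.2 - p₀.2 - k / l * (p.1 - p₀.1)) ^ 2 + 24 * c ^ 2 * (p.1 - p₀.1))
    (fun p => 4 * (p.2 - p₀.2 - k / l * (p.1 - p₀.1)) ^ 3
        - 24 * c * (p.1 - p₀.1) * (p.2 - p₀.2 - k / l * (p.1 - p₀.1)))
    (fun p => 12 * (p.2 - p₀.2 - k / l * (p.1 - p₀.1)) ^ 2 - 24 * c * (p.1 - p₀.1)) where
  smooth := by unfold heatQuartic; fun_prop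
  t := fun p => by
    have hτ : HasDerivAt (fun s => s - p₀.1) 1 p.1 := (hasDerivAt_id p.1).sub_const p₀.1
    refine ((((hasDerivAt_drift_t p).fun_pow 4).sub ((hτ.const_mul (12 * c)).mul
      ((hasDerivAt_drift_t p).fun_pow 2))).add
      ((hτ.fun_pow 2).const_mul (12 * c ^ 2))).congr_deriv ?_
    simp
    ring
  x := fun p => by
    have hy := hasDerivAt_drift_x (k := k) (l := l) (p₀ := p₀) p
    refine (((hy.fun_pow 4).sub ((hy.fun_pow 2).const_mul
      (12 * c * (p.1 - p₀.1)))).add_const (12 * c ^ 2 * (p.1 - p₀.1) ^ 2)).congr_deriv ?_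
    simp
    ring
  xx := fun p => by
    refine ((((hasDerivAt_drift_x p).fun_pow 3).const_mul 4).sub
      ((hasDerivAt_drift_x p).const_mul (24 * c * (p.1 - p₀.1)))).congr_deriv ?_
    simp
    ring
  eq := fun p => by ring

theorem IsHeat.hasDerivAt_hopfCole_t (hZ : IsHeat c l k Z Zt Zx Zxx) {p : ℝ × ℝ}
    (hp : 0 < 1 + Z p) : HasDerivAt (fun s => hopfCole c l k v₀ p₀ Z (s, p.2))
      (-(k ^ 2 / (2 * l)) + 2 * l * c * (Zt p / (1 + Z p))) p.1 := by
  refine (((((hasDerivAt_id p.1).sub_const p₀.1).const_mul (k ^ 2 / (2 * l))).const_sub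
    (v₀ + k * (p.2 - p₀.2))).add ((((hZ.t p).const_add 1).log hp.ne').const_mul
      (2 * l * c))).congr_deriv ?_
  simp

theorem IsHeat.hasDerivAt_hopfCole_x (hZ : IsHeat c l k Z Zt Zx Zxx) {p : ℝ × ℝ}
    (hp : 0 < 1 + Z p) : HasDerivAt (fun y => hopfCole c l k v₀ p₀ Z (p.1, y))
      (k + 2 * l * c * (Zx p / (1 + Z p))) p.2 := by
  refine ((((((hasDerivAt_id p.2).sub_const p₀.2).const_mul k).const_add v₀).sub_const
    (k ^ 2 / (2 * l) * (p.1 - p₀.1))).add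
    ((((hZ.x p).const_add 1).log hp.ne').const_mul (2 * l * c))).congr_deriv ?_
  simp

theorem IsHeat.contDiffOn_hopfCole (hZ : IsHeat c l k Z Zt Zx Zxx) {Ω : Set (ℝ × ℝ)}
    (hpos : ∀ p ∈ Ω, 0 < 1 + Z p) : ContDiffOn ℝ ∞ (hopfCole c l k v₀ p₀ Z) Ω := by
  have h1 : ContDiffOn ℝ ∞ (fun p => Real.log (1 + Z p)) Ω :=
    (contDiff_const.add hZ.smooth).contDiffOn.log fun p hp => (hpos p hp).ne'
  have h2 : ContDiff ℝ ∞ (fun p : ℝ × ℝ =>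
      v₀ + k * (p.2 - p₀.2) - k ^ 2 / (2 * l) * (p.1 - p₀.1)) := by fun_prop
  exact h2.contDiffOn.add (contDiffOn_const.mul h1)

theorem IsHeat.isSolutionOn_hopfCole (hZ : IsHeat c l k Z Zt Zx Zxx) (hl : l ≠ 0) {E : PotEq}
    (hE : ∀ p ∈ E.D, E.f p = c ∧ dx E.f p = 0 ∧ E.lam p.1 = l) {Ω : Set (ℝ × ℝ)} (hΩ : IsOpen Ω)
    (hΩE : Ω ⊆ E.D) (hpos : ∀ p ∈ Ω, 0 < 1 + Z p) :
    E.IsSolutionOn (hopfCole c l k v₀ p₀ Z) Ω := by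
  refine ⟨hZ.contDiffOn_hopfCole hpos, fun p hp => ?_⟩
  obtain ⟨h1, h2, h3⟩ := hE p (hΩE hp)
  have hne := (hpos p hp).ne'
  have ht : dt (hopfCole c l k v₀ p₀ Z) p = _ := (hZ.hasDerivAt_hopfCole_t (hpos p hp)).deriv
  have hx : dx (hopfCole c l k v₀ p₀ Z) p = _ := (hZ.hasDerivAt_hopfCole_x (hpos p hp)).deriv
  have hxx : dx (dx (hopfCole c l k v₀ p₀ Z)) p =
      2 * l * c * ((Zxx p * (1 + Z p) - Zx p * Zx p) / (1 + Z p) ^ 2) := by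
    have : HasDerivAt (fun y => k + 2 * l * c * (Zx (p.1, y) / (1 + Z (p.1, y)))) _ p.2 :=
      (((hZ.xx p).div ((hZ.x p).const_add 1) hne).const_mul (2 * l * c)).const_add k
    refine (Filter.EventuallyEq.deriv_eq ?_).trans this.deriv
    filter_upwards [eventually_slice_mem hΩ hp] with y hy
    exact (hZ.hasDerivAt_hopfCole_x (hpos _ hy)).deriv
  have hZt : Zt p = -(k / l * Zx p) - c * Zxx p := by linarith [hZ.eq p]
  rw [ht, hx, hxx, h1, h2, h3, hZt]
  field_simp
  ring

theorem IsHeat.pd_hopfCole_t (hZ : IsHeat c l k Z Zt Zx Zxx) (h0 : Z p₀ = 0) :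
    pd (1, 0) (hopfCole c l k v₀ p₀ Z) p₀ = -(k ^ 2 / (2 * l)) + 2 * l * c * Zt p₀ := by
  have hpos : 0 < 1 + Z p₀ := by rw [h0]; norm_num
  have hU : IsOpen {p | 0 < 1 + Z p} := isOpen_lt continuous_const
    (continuous_const.add hZ.smooth.continuous)
  have hd := differentiableAt_of_contDiffOn hU
    (hZ.contDiffOn_hopfCole (v₀ := v₀) (p₀ := p₀) fun p hp => hp) hpos
  have := (hasDerivAt_slice_fst hd).unique (hZ.hasDerivAt_hopfCole_t hpos)
  rw [this, h0]
  ring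

theorem IsHeat.pd_hopfCole_x (hZ : IsHeat c l k Z Zt Zx Zxx) (h0 : Z p₀ = 0) :
    pd (0, 1) (hopfCole c l k v₀ p₀ Z) p₀ = k + 2 * l * c * Zx p₀ := by
  have hpos : 0 < 1 + Z p₀ := by rw [h0]; norm_num
  have hU : IsOpen {p | 0 < 1 + Z p} := isOpen_lt continuous_const
    (continuous_const.add hZ.smooth.continuous)
  have hd := differentiableAt_of_contDiffOn hU
    (hZ.contDiffOn_hopfCole (v₀ := v₀) (p₀ := p₀) fun p hp => hp) hpos
  have := (hasDerivAt_slice_snd hd).unique (hZ.hasDerivAt_hopfCole_x hpos)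
  rw [this, h0]
  ring

theorem hopfCole_self (h0 : Z p₀ = 0) : hopfCole c l k v₀ p₀ Z p₀ = v₀ := by
  simp [hopfCole, h0]

theorem hopfCole_sub_isLittleO (hZ : ContDiff ℝ ∞ Z) (h0 : Z p₀ = 0) :
    (fun p => hopfCole c l k v₀ p₀ Z p - hopfCole c l k v₀ p₀ (fun _ => 0) p - 2 * l * c * Z p)
      =o[𝓝 p₀] Z := by
  have hlog : (fun z : ℝ => Real.log (1 + z) - z) =o[𝓝 0] fun z => z := by
    have h1 : HasDerivAt (fun z : ℝ => Real.log (1 + z)) 1 0 := by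
      simpa using (((hasDerivAt_id (0 : ℝ)).const_add 1).log (by norm_num))
    simpa using h1.isLittleO
  have hZ0 : Tendsto Z (𝓝 p₀) (𝓝 0) := by
    simpa [ContinuousAt, h0] using hZ.continuous.continuousAt (x := p₀)
  refine ((hlog.comp_tendsto hZ0).const_mul_left (2 * l * c)).congr_left fun p => ?_
  simp [hopfCole]
  ring

theorem PointTransformation.Carries.exists_localImage_hopfCole {ψ : PointTransformation}
    {E E' : PotEq} (h : ψ.Carries E E') (hl : l ≠ 0)
    (hE : ∀ p ∈ E.D, E.f p = c ∧ dx E.f p = 0 ∧ E.lam p.1 = l) {q : ℝ × ℝ × ℝ} (hq : q ∈ ψ.dom)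
    (hZ : IsHeat c l k Z Zt Zx Zxx) (h0 : Z (proj q) = 0)
    (hJ : ψ.jac q (-(k ^ 2 / (2 * l)) + 2 * l * c * Zt (proj q))
      (k + 2 * l * c * Zx (proj q)) ≠ 0) :
    ∃ Ω' v' Ψ, IsLocalImage ψ (hopfCole c l k q.2.2 (proj q) Z) (proj q) Ω' v' Ψ ∧
      E'.IsSolutionOn v' Ω' := by
  have hq' : lift (hopfCole c l k q.2.2 (proj q) Z) (proj q) = q := by
    unfold lift
    rw [hopfCole_self h0]
    rfl
  have hU : IsOpen (E.D ∩ {p | 0 < 1 + Z p}) := E.isOpen_D.inter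
    (isOpen_lt continuous_const (continuous_const.add hZ.smooth.continuous))
  refine h.exists_localImage hU
    (hZ.isSolutionOn_hopfCole hl hE hU Set.inter_subset_left fun p hp => hp.2)
    ⟨h.1 q hq, ?_⟩ ?_ ?_
  · simp [h0]
  · rwa [hq']
  · rwa [hq', hZ.pd_hopfCole_t h0, hZ.pd_hopfCole_x h0]

end

/-! ### Comparison of the images of two solutions -/

theorem pd_triple (F : ℝ × ℝ × ℝ → ℝ) (q : ℝ × ℝ × ℝ) (a b d : ℝ) :
    pd (a, b, d) F q = a * pd (1, 0, 0) F q + b * pd (0, 1, 0) F q + d * pd (0, 0, 1) F q := by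
  have : ((a, b, d) : ℝ × ℝ × ℝ) = a • (1, 0, 0) + b • (0, 1, 0) + d • (0, 0, 1) := by simp
  simp only [pd]
  rw [this]
  simp only [map_add, map_smul, smul_eq_mul]

theorem pd_pair (F : ℝ × ℝ → ℝ) (p : ℝ × ℝ) (a b : ℝ) :
    pd (a, b) F p = a * pd (1, 0) F p + b * pd (0, 1) F p := by
  have : ((a, b) : ℝ × ℝ) = a • (1, 0) + b • (0, 1) := by simp
  simp only [pd]
  rw [this]
  simp only [map_add, map_smul, smul_eq_mul]

/-- If two solutions have the difference `m Z + o(Z)` near a point, the difference of their images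
is `g (Z ∘ Ψ₂) + o(Z ∘ Ψ₂)` with a nonzero constant `g`. With `G = V - v₁' ∘ (T, X)`, which
vanishes on the graph of `v₁`, this is the strict differentiability of `G` in the direction of
`v`; if `G_v` were zero, the differentials of `T`, `X`, `V` would be linearly dependent. -/
theorem IsLocalImage.exists_sub_isLittleO {ψ : PointTransformation} {v₁ v₂ v₁' v₂' : ℝ × ℝ → ℝ}
    {p₀ : ℝ × ℝ} {Ω₁ Ω₂ : Set (ℝ × ℝ)} {Ψ₁ Ψ₂ : ℝ × ℝ → ℝ × ℝ}
    (h₁ : IsLocalImage ψ v₁ p₀ Ω₁ v₁' Ψ₁) (h₂ : IsLocalImage ψ v₂ p₀ Ω₂ v₂' Ψ₂)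
    (hv₁ : DifferentiableAt ℝ v₁ p₀) (hv₂ : ContinuousAt v₂ p₀) (h0 : v₁ p₀ = v₂ p₀)
    {Z : ℝ × ℝ → ℝ} {m : ℝ} (hm : m ≠ 0)
    (hZ : (fun p => v₂ p - v₁ p - m * Z p) =o[𝓝 p₀] Z) :
    ∃ g : ℝ, g ≠ 0 ∧ (fun p' => v₂' p' - v₁' p' - g * Z (Ψ₂ p'))
      =o[𝓝 (ψ.base (lift v₂ p₀))] fun p' => Z (Ψ₂ p') := by
  set q₀ := lift v₁ p₀ with hq₀
  have hq₂ : lift v₂ p₀ = q₀ := by rw [hq₀]; unfold lift; rw [h0]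
  rw [hq₂]
  have hqdom : q₀ ∈ ψ.dom := by
    have := h₁.lift_mem _ h₁.mem
    rwa [h₁.inv_base] at this
  set G : ℝ × ℝ × ℝ → ℝ := fun q => ψ.V q - v₁' (ψ.base q) with hG
  have hVc : ContDiffAt ℝ ∞ ψ.V q₀ := ψ.smooth_V.contDiffAt (ψ.isOpen_dom.mem_nhds hqdom)
  have hbc : ContDiffAt ℝ ∞ ψ.base q₀ :=
    ψ.contDiffOn_base.contDiffAt (ψ.isOpen_dom.mem_nhds hqdom)
  have hv'c : ContDiffAt ℝ ∞ v₁' (ψ.base q₀) := h₁.smooth.contDiffAt (h₁.isOpen.mem_nhds h₁.mem)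
  have hGc : ContDiffAt ℝ ∞ G q₀ := hVc.sub (hv'c.comp q₀ hbc)
  have hGd : DifferentiableAt ℝ G q₀ := hGc.differentiableAt (by simp)
  have hG0 : ∀ᶠ p in 𝓝 p₀, G (lift v₁ p) = 0 := by
    filter_upwards [h₁.eventually_eq] with p hp
    simp only [hG, hp, sub_self]
  have hGv : pd (0, 0, 1) G q₀ ≠ 0 := by
    intro hzero
    have htan (e : ℝ × ℝ) : pd (e.1, e.2, pd e v₁ p₀) G q₀ = 0 := by
      rw [← pd_comp_lift hv₁ hGd]
      have : (fun r => G (lift v₁ r)) =ᶠ[𝓝 p₀] fun _ => 0 := hG0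
      simp [pd, this.fderiv_eq]
    have hall (e : ℝ × ℝ × ℝ) : pd e G q₀ = 0 := by
      have := htan (e.1, e.2.1)
      have he : e = (e.1, e.2.1, e.2.2) := rfl
      rw [pd_triple, hzero] at this
      rw [he, pd_triple, hzero]
      linarith
    -- In a direction with `dT = dX = 0` and `dV = 1` the derivative of `G` is `1`.
    obtain ⟨e, he1, he2, he3⟩ := ψ.exists_direction hqdom 0 0 1
    have hb : fderiv ℝ ψ.base q₀ e = 0 := by
      have hT := (differentiableAt_of_contDiffOn ψ.isOpen_dom ψ.smooth_T hqdom).hasFDerivAt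
      have hX := (differentiableAt_of_contDiffOn ψ.isOpen_dom ψ.smooth_X hqdom).hasFDerivAt
      have h : fderiv ℝ ψ.base q₀ = _ := (hT.prodMk hX).fderiv
      rw [h]
      exact Prod.ext he1 he2
    have hGe : pd e G q₀ = pd e ψ.V q₀ := by
      have h : HasFDerivAt G _ q₀ := (hVc.differentiableAt (by simp)).hasFDerivAt.sub
        ((hv'c.differentiableAt (by simp)).hasFDerivAt.comp q₀
          (hbc.differentiableAt (by simp)).hasFDerivAt)
      simp only [pd]
      rw [h.fderiv]
      simp [hb]
    rw [hall e, he3] at hGe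
    exact zero_ne_one hGe
  have hδ : (fun p => v₂ p - v₁ p) =O[𝓝 p₀] Z := by
    have := hZ.isBigO.add ((isBigO_refl Z (𝓝 p₀)).const_mul_left m)
    simpa using this
  have hstrict : (fun p => G (lift v₂ p) - G (lift v₁ p) - pd (0, 0, 1) G q₀ * (v₂ p - v₁ p))
      =o[𝓝 p₀] Z := by
    have h1 := (hGc.hasStrictFDerivAt (by simp)).isLittleO
    have hl₁ : Tendsto (lift v₁) (𝓝 p₀) (𝓝 q₀) :=
      (hasFDerivAt_lift hv₁).differentiableAt.continuousAt
    have hl₂ : Tendsto (lift v₂) (𝓝 p₀) (𝓝 q₀) := by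
      rw [← hq₂]
      exact continuousAt_fst.prodMk (continuousAt_snd.prodMk hv₂)
    have h2 := h1.comp_tendsto (hl₂.prodMk_nhds hl₁)
    have hsub (p : ℝ × ℝ) : lift v₂ p - lift v₁ p = (v₂ p - v₁ p) • (0, 0, 1) := by
      simp [lift]
    refine (h2.congr_left fun p => ?_).trans_isBigO (IsBigO.trans ?_ hδ)
    · simp only [Function.comp_apply, hsub, map_smul, smul_eq_mul, pd]
      ring
    · refine IsBigO.of_bound 1 (Eventually.of_forall fun p => ?_)
      simp only [Function.comp_apply, hsub, norm_smul]
      simp [Prod.norm_def]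
  have hsum : (fun p => G (lift v₂ p) - pd (0, 0, 1) G q₀ * m * Z p) =o[𝓝 p₀] Z := by
    refine (hstrict.add (hZ.const_mul_left (pd (0, 0, 1) G q₀))).congr' ?_ EventuallyEq.rfl
    filter_upwards [hG0] with p hp
    rw [hp]
    ring
  refine ⟨pd (0, 0, 1) G q₀ * m, mul_ne_zero hGv hm, ?_⟩
  have hmem₂ : ψ.base q₀ ∈ Ω₂ := hq₂ ▸ h₂.mem
  have hΨ : Tendsto Ψ₂ (𝓝 (ψ.base q₀)) (𝓝 p₀) := by
    have := (differentiableAt_of_contDiffOn h₂.isOpen h₂.smooth_inv hmem₂).continuousAt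
    have hinv : Ψ₂ (ψ.base q₀) = p₀ := by rw [← hq₂]; exact h₂.inv_base
    simpa [ContinuousAt, hinv] using this
  refine (hsum.comp_tendsto hΨ).congr' ?_ EventuallyEq.rfl
  filter_upwards [h₂.isOpen.mem_nhds hmem₂] with p' hp'
  simp only [Function.comp_apply, hG, h₂.V_inv p' hp', h₂.base_inv p' hp']

/-- The derivative of the local inverse `Ψ` along a curve. -/
theorem IsLocalImage.exists_hasDerivAt_inv {ψ : PointTransformation} {v v' : ℝ × ℝ → ℝ}
    {p₀ : ℝ × ℝ} {Ω' : Set (ℝ × ℝ)} {Ψ : ℝ × ℝ → ℝ × ℝ} (h : IsLocalImage ψ v p₀ Ω' v' Ψ)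
    (hv : DifferentiableAt ℝ v p₀) {γ : ℝ → ℝ × ℝ} {s₀ : ℝ} {e' : ℝ × ℝ}
    (hγ : HasDerivAt γ e' s₀) (h0 : γ s₀ = ψ.base (lift v p₀)) :
    ∃ e : ℝ × ℝ, HasDerivAt (fun s => Ψ (γ s)) e s₀ ∧
      e.1 * pd (1, 0, pd (1, 0) v p₀) ψ.T (lift v p₀)
        + e.2 * pd (0, 1, pd (0, 1) v p₀) ψ.T (lift v p₀) = e'.1 ∧
      e.1 * pd (1, 0, pd (1, 0) v p₀) ψ.X (lift v p₀)
        + e.2 * pd (0, 1, pd (0, 1) v p₀) ψ.X (lift v p₀) = e'.2 := by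
  have hqdom : lift v p₀ ∈ ψ.dom := by
    have := h.lift_mem _ h.mem
    rwa [h.inv_base] at this
  have hγmem : ∀ᶠ s in 𝓝 s₀, γ s ∈ Ω' :=
    hγ.continuousAt.eventually_mem (h.isOpen.mem_nhds (h0 ▸ h.mem))
  have hΨd : HasFDerivAt Ψ (fderiv ℝ Ψ (γ s₀)) (γ s₀) :=
    (differentiableAt_of_contDiffOn h.isOpen h.smooth_inv (h0 ▸ h.mem)).hasFDerivAt
  have hΨγ : Ψ (γ s₀) = p₀ := by rw [h0, h.inv_base]
  set e : ℝ × ℝ := fderiv ℝ Ψ (γ s₀) e' with he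
  have hd : HasDerivAt (fun s => Ψ (γ s)) e s₀ := hΨd.comp_hasDerivAt s₀ hγ
  have key (F : ℝ × ℝ × ℝ → ℝ) (hF : DifferentiableAt ℝ F (lift v p₀)) :
      HasDerivAt (fun s => F (lift v (Ψ (γ s))))
        (e.1 * pd (1, 0, pd (1, 0) v p₀) F (lift v p₀)
          + e.2 * pd (0, 1, pd (0, 1) v p₀) F (lift v p₀)) s₀ := by
    have h1 : DifferentiableAt ℝ (fun r => F (lift v r)) (Ψ (γ s₀)) := by
      rw [hΨγ]
      exact hF.comp p₀ (hasFDerivAt_lift hv).differentiableAt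
    refine (hasDerivAt_comp_pd (F := fun r => F (lift v r)) h1 hd).congr_deriv ?_
    rw [hΨγ, pd_pair (a := e.1) (b := e.2), pd_comp_lift hv hF, pd_comp_lift hv hF]
  refine ⟨e, hd, ?_, ?_⟩
  · refine (key ψ.T (differentiableAt_of_contDiffOn ψ.isOpen_dom ψ.smooth_T hqdom)).unique ?_
    have h1 : HasDerivAt (fun s => (γ s).1) e'.1 s₀ :=
      (hasFDerivAt_fst (𝕜 := ℝ) (p := γ s₀)).comp_hasDerivAt s₀ hγ
    refine h1.congr_of_eventuallyEq ?_
    filter_upwards [hγmem] with s hs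
    exact congrArg (fun z : ℝ × ℝ => z.1) (h.base_inv _ hs)
  · refine (key ψ.X (differentiableAt_of_contDiffOn ψ.isOpen_dom ψ.smooth_X hqdom)).unique ?_
    have h1 : HasDerivAt (fun s => (γ s).2) e'.2 s₀ :=
      (hasFDerivAt_snd (𝕜 := ℝ) (p := γ s₀)).comp_hasDerivAt s₀ hγ
    refine h1.congr_of_eventuallyEq ?_
    filter_upwards [hγmem] with s hs
    exact congrArg (fun z : ℝ × ℝ => z.2) (h.base_inv _ hs)

theorem tendsto_div_pow_of_isLittleO {R S : ℝ × ℝ → ℝ} {g L s₀ : ℝ} {n : ℕ} {γ : ℝ → ℝ × ℝ}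
    (h : (fun p => R p - g * S p) =o[𝓝 (γ s₀)] S) (hγ : ContinuousAt γ s₀)
    (hL : Tendsto (fun s => S (γ s) / (s - s₀) ^ n) (𝓝[≠] s₀) (𝓝 L)) :
    Tendsto (fun s => R (γ s) / (s - s₀) ^ n) (𝓝[≠] s₀) (𝓝 (g * L)) := by
  have hO : (fun s => S (γ s)) =O[𝓝[≠] s₀] fun s => (s - s₀) ^ n := by
    refine isBigO_of_div_tendsto_nhds ?_ L hL
    filter_upwards [self_mem_nhdsWithin] with s hs h0
    exact absurd h0 (pow_ne_zero n (sub_ne_zero.2 hs))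
  have ho := ((h.comp_tendsto (hγ.tendsto.mono_left nhdsWithin_le_nhds)).trans_isBigO
    hO).tendsto_div_nhds_zero
  have := ho.add (hL.const_mul g)
  rw [zero_add] at this
  refine this.congr fun s => ?_
  simp only [Function.comp_apply]
  ring

theorem hasDerivAt_of_tendsto_div {F : ℝ → ℝ} {s₀ L : ℝ} (h0 : F s₀ = 0)
    (h : Tendsto (fun s => F s / (s - s₀) ^ 1) (𝓝[≠] s₀) (𝓝 L)) : HasDerivAt F L s₀ := by
  rw [hasDerivAt_iff_tendsto_slope]
  refine h.congr fun s => ?_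
  rw [slope_def_field, h0, sub_zero, pow_one]

theorem tendsto_div_of_hasDerivAt {f : ℝ → ℝ} {s₀ a d : ℝ} (h : HasDerivAt f d s₀)
    (ha : f s₀ = a) : Tendsto (fun s => (f s - a) / (s - s₀)) (𝓝[≠] s₀) (𝓝 d) := by
  subst ha
  refine (hasDerivAt_iff_tendsto_slope.1 h).congr fun s => ?_
  rw [slope_def_field]

theorem dx_dx_eq_of_tendsto {R : ℝ × ℝ → ℝ} {Ω : Set (ℝ × ℝ)} (hΩ : IsOpen Ω)
    (hR : ContDiffOn ℝ ∞ R Ω) {p : ℝ × ℝ} (hp : p ∈ Ω) (h0 : R p = 0) (h1 : dx R p = 0) {L : ℝ}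
    (hL : Tendsto (fun y => R (p.1, y) / (y - p.2) ^ 2) (𝓝[≠] p.2) (𝓝 L)) :
    dx (dx R) p = 2 * L := by
  refine deriv_deriv_eq_of_tendsto (F := fun y => R (p.1, y)) ?_ ?_ h0 h1 hL
  · filter_upwards [eventually_slice_mem hΩ hp] with y hy
    exact (hasDerivAt_slice_snd (p := (p.1, y))
      (differentiableAt_of_contDiffOn hΩ hR hy)).differentiableAt
  · have h := hasDerivAt_slice_snd
      (differentiableAt_of_contDiffOn hΩ (contDiffOn_pd hΩ hR (0, 1)) hp)
    refine h.differentiableAt.congr_of_eventuallyEq ?_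
    filter_upwards [eventually_slice_mem hΩ hp] with y hy
    exact (hasDerivAt_slice_snd (p := (p.1, y)) (differentiableAt_of_contDiffOn hΩ hR hy)).deriv

/-- For two solutions with the same `x`-derivative at a point only the principal part of the
equation contributes to the equation for their difference. -/
theorem PotEq.IsSolutionOn.dt_sub_add {E : PotEq} {v w : ℝ × ℝ → ℝ} {Ω₁ Ω₂ : Set (ℝ × ℝ)}
    (hv : E.IsSolutionOn v Ω₁) (hw : E.IsSolutionOn w Ω₂) (hΩ₁ : IsOpen Ω₁) (hΩ₂ : IsOpen Ω₂)
    {p : ℝ × ℝ} (hp₁ : p ∈ Ω₁) (hp₂ : p ∈ Ω₂) (h : dx (fun r => w r - v r) p = 0) :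
    dt (fun r => w r - v r) p + E.f p * dx (dx fun r => w r - v r) p = 0 := by
  have hΩ := hΩ₁.inter hΩ₂
  have hv' : ContDiffOn ℝ ∞ v (Ω₁ ∩ Ω₂) := hv.1.mono Set.inter_subset_left
  have hw' : ContDiffOn ℝ ∞ w (Ω₁ ∩ Ω₂) := hw.1.mono Set.inter_subset_right
  have hp : p ∈ Ω₁ ∩ Ω₂ := ⟨hp₁, hp₂⟩
  have hsub {a b : ℝ × ℝ → ℝ} (ha : ContDiffOn ℝ ∞ a (Ω₁ ∩ Ω₂))
      (hb : ContDiffOn ℝ ∞ b (Ω₁ ∩ Ω₂)) (e r) (hr : r ∈ Ω₁ ∩ Ω₂) :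
      pd e (fun z => a z - b z) r = pd e a r - pd e b r := by
    simp only [pd]
    rw [fderiv_fun_sub (differentiableAt_of_contDiffOn hΩ ha hr)
      (differentiableAt_of_contDiffOn hΩ hb hr)]
    rfl
  have hvd := differentiableAt_of_contDiffOn hΩ hv' hp
  have hwd := differentiableAt_of_contDiffOn hΩ hw' hp
  have hwv : ContDiffOn ℝ ∞ (fun r => w r - v r) (Ω₁ ∩ Ω₂) := hw'.sub hv'
  have hd := differentiableAt_of_contDiffOn hΩ hwv hp
  have e1 := hv.2 p hp₁
  have e2 := hw.2 p hp₂
  rw [dt_eq_pd hvd, dx_eq_pd hvd, dx_dx_eq_pd hΩ hv' hp] at e1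
  rw [dt_eq_pd hwd, dx_eq_pd hwd, dx_dx_eq_pd hΩ hw' hp] at e2
  rw [dx_eq_pd hd, hsub hw' hv' _ _ hp] at h
  rw [dt_eq_pd hd, hsub hw' hv' _ _ hp, dx_dx_eq_pd hΩ hwv hp,
    pd_congr hΩ (hsub hw' hv' (0, 1)) hp,
    hsub (contDiffOn_pd hΩ hw' _) (contDiffOn_pd hΩ hv' _) _ _ hp]
  have h' : pd (0, 1) w p = pd (0, 1) v p := by linarith
  rw [h'] at e2
  linarith

/-! ### The form of the components `T` and `X` -/

section

variable {c l k : ℝ} {p₀ : ℝ × ℝ} {P : ℝ → ℝ × ℝ} {e : ℝ × ℝ} {s₀ : ℝ}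

theorem tendsto_fst_div (hP : HasDerivAt P e s₀) (h0 : P s₀ = p₀) :
    Tendsto (fun s => ((P s).1 - p₀.1) / (s - s₀)) (𝓝[≠] s₀) (𝓝 e.1) :=
  tendsto_div_of_hasDerivAt (f := fun s => (P s).1)
    ((hasFDerivAt_fst (𝕜 := ℝ) (p := P s₀)).comp_hasDerivAt s₀ hP) (by rw [h0])

theorem tendsto_snd_div (hP : HasDerivAt P e s₀) (h0 : P s₀ = p₀) :
    Tendsto (fun s => ((P s).2 - p₀.2) / (s - s₀)) (𝓝[≠] s₀) (𝓝 e.2) :=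
  tendsto_div_of_hasDerivAt (f := fun s => (P s).2)
    ((hasFDerivAt_snd (𝕜 := ℝ) (p := P s₀)).comp_hasDerivAt s₀ hP) (by rw [h0])

theorem tendsto_sub_nhdsNE (s₀ : ℝ) : Tendsto (fun s => s - s₀) (𝓝[≠] s₀) (𝓝 0) := by
  have : ContinuousAt (fun s : ℝ => s - s₀) s₀ := by fun_prop
  simpa [ContinuousAt] using this.tendsto.mono_left nhdsWithin_le_nhds

theorem tendsto_heatQuartic_div_sq (hP : HasDerivAt P e s₀) (h0 : P s₀ = p₀) :
    Tendsto (fun s => heatQuartic c l k p₀ (P s) / (s - s₀) ^ 2) (𝓝[≠] s₀)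
      (𝓝 (12 * c ^ 2 * e.1 ^ 2)) := by
  have ht := tendsto_fst_div hP h0
  have hx := tendsto_snd_div hP h0
  have hh := tendsto_sub_nhdsNE s₀
  have hy := hx.sub (ht.const_mul (k / l))
  have := (((hy.pow 4).mul (hh.pow 2)).sub (((ht.const_mul (12 * c)).mul (hy.pow 2)).mul hh)).add
    ((ht.pow 2).const_mul (12 * c ^ 2))
  simp only [ne_eq, OfNat.ofNat_ne_zero, not_false_eq_true, zero_pow, mul_zero, sub_zero,
    zero_add] at this
  refine this.congr' ?_
  filter_upwards [self_mem_nhdsWithin] with s hs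
  have hs' : s - s₀ ≠ 0 := sub_ne_zero.2 hs
  have hyy : ((P s).2 - p₀.2) / (s - s₀) - k / l * (((P s).1 - p₀.1) / (s - s₀))
      = ((P s).2 - p₀.2 - k / l * ((P s).1 - p₀.1)) / (s - s₀) := by ring
  rw [hyy, heatQuartic]
  field_simp

theorem tendsto_heatQuartic_div (hP : HasDerivAt P e s₀) (h0 : P s₀ = p₀) :
    Tendsto (fun s => heatQuartic c l k p₀ (P s) / (s - s₀) ^ 1) (𝓝[≠] s₀) (𝓝 0) := by
  have := (tendsto_heatQuartic_div_sq (c := c) (l := l) (k := k) hP h0).mul (tendsto_sub_nhdsNE s₀)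
  rw [mul_zero] at this
  refine this.congr' ?_
  filter_upwards [self_mem_nhdsWithin] with s hs
  have hs' : s - s₀ ≠ 0 := sub_ne_zero.2 hs
  field_simp

theorem tendsto_heatQuadratic_div (hP : HasDerivAt P e s₀) (h0 : P s₀ = p₀) :
    Tendsto (fun s => heatQuadratic c l k p₀ (P s) / (s - s₀) ^ 1) (𝓝[≠] s₀)
      (𝓝 (-(2 * c * e.1))) := by
  have ht := tendsto_fst_div hP h0
  have hx := tendsto_snd_div hP h0
  have hh := tendsto_sub_nhdsNE s₀
  have hy := hx.sub (ht.const_mul (k / l))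
  have := ((hy.pow 2).mul hh).sub (ht.const_mul (2 * c))
  simp only [mul_zero, zero_sub] at this
  refine this.congr' ?_
  filter_upwards [self_mem_nhdsWithin] with s hs
  have hs' : s - s₀ ≠ 0 := sub_ne_zero.2 hs
  have hyy : ((P s).2 - p₀.2) / (s - s₀) - k / l * (((P s).1 - p₀.1) / (s - s₀))
      = ((P s).2 - p₀.2 - k / l * ((P s).1 - p₀.1)) / (s - s₀) := by ring
  rw [hyy, heatQuadratic]
  field_simp

theorem tendsto_heatQuadratic_div_sq (hP : HasDerivAt P e s₀) (h0 : P s₀ = p₀)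
    (ht : ∀ᶠ s in 𝓝 s₀, (P s).1 = p₀.1) :
    Tendsto (fun s => heatQuadratic c l k p₀ (P s) / (s - s₀) ^ 2) (𝓝[≠] s₀) (𝓝 (e.2 ^ 2)) := by
  refine ((tendsto_snd_div hP h0).pow 2).congr' ?_
  filter_upwards [ht.filter_mono nhdsWithin_le_nhds] with s hs
  rw [div_pow, heatQuadratic, hs]
  congr 1
  ring

end

section

variable {ψ : PointTransformation} {E E' : PotEq} {c l : ℝ}

/-- The Jacobian determinant along the graph of a linear solution with slope `k` is a polynomial
in `k` of degree at most two, whose coefficients are the `2 × 2` minors of the differential of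
`(T, X)`. -/
theorem PointTransformation.eventually_jac_ne_zero {q : ℝ × ℝ × ℝ} (hq : q ∈ ψ.dom) (hl : l ≠ 0) :
    ∀ᶠ k : ℝ in cofinite, ψ.jac q (-(k ^ 2 / (2 * l))) k ≠ 0 := by
  by_contra hcon
  rw [Filter.not_eventually] at hcon
  set Tt := pd (1, 0, 0) ψ.T q with hTt
  set Tx := pd (0, 1, 0) ψ.T q with hTx
  set Tv := pd (0, 0, 1) ψ.T q with hTv
  set Xt := pd (1, 0, 0) ψ.X q with hXt
  set Xx := pd (0, 1, 0) ψ.X q with hXx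
  set Xv := pd (0, 0, 1) ψ.X q with hXv
  have hfr : ∃ᶠ k : ℝ in cofinite, (Tt * Xx - Tx * Xt) + (Tt * Xv - Tv * Xt) * k
      + (-(Tv * Xx - Tx * Xv) / (2 * l)) * k ^ 2 = 0 := by
    refine hcon.mono fun k hk => ?_
    have hk' := not_not.1 hk
    rw [PointTransformation.jac, pd_triple ψ.T q 1 0 (-(k ^ 2 / (2 * l))),
      pd_triple ψ.X q 0 1 k, pd_triple ψ.T q 0 1 k, pd_triple ψ.X q 1 0 (-(k ^ 2 / (2 * l))),
      ← hTt, ← hTx, ← hTv, ← hXt, ← hXx, ← hXv] at hk'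
    rw [← hk']
    ring
  obtain ⟨m1, m2, m3⟩ := coeffs_eq_zero_of_frequently hfr
  replace m3 : Tv * Xx - Tx * Xv = 0 := by
    have h2l : (2 * l) ≠ 0 := mul_ne_zero two_ne_zero hl
    rcases div_eq_zero_iff.1 m3 with h | h
    · linarith
    · exact absurd h h2l
  obtain ⟨e, he1, he2, -⟩ := ψ.exists_direction hq 1 0 0
  obtain ⟨d, -, hd2, -⟩ := ψ.exists_direction hq 0 1 0
  rw [show e = (e.1, e.2.1, e.2.2) from rfl, pd_triple] at he1 he2
  rw [show d = (d.1, d.2.1, d.2.2) from rfl, pd_triple] at hd2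
  rw [← hTt, ← hTx, ← hTv] at he1
  rw [← hXt, ← hXx, ← hXv] at he2 hd2
  have h1 : Xt = 0 := by
    linear_combination -Xt * he1 + Tt * he2 - e.2.1 * m1 - e.2.2 * m2
  have h2 : Xx = 0 := by
    linear_combination -Xx * he1 + Tx * he2 + e.1 * m1 + e.2.2 * m3
  have h3 : Xv = 0 := by
    linear_combination -Xv * he1 + Tv * he2 + e.1 * m2 - e.2.1 * m3
  rw [h1, h2, h3] at hd2
  norm_num at hd2

/-- The images of the linear solution with slope `k` through `q` and of its perturbation by `Z`. -/
theorem PointTransformation.Carries.exists_difference (h : ψ.Carries E E') (hl : l ≠ 0)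
    (hc : c ≠ 0) (hE : ∀ p ∈ E.D, E.f p = c ∧ dx E.f p = 0 ∧ E.lam p.1 = l) {q : ℝ × ℝ × ℝ}
    (hq : q ∈ ψ.dom) {k : ℝ} {Z Zt Zx Zxx : ℝ × ℝ → ℝ} (hZ : IsHeat c l k Z Zt Zx Zxx)
    (h0 : Z (proj q) = 0) (hJ₁ : ψ.jac q (-(k ^ 2 / (2 * l))) k ≠ 0)
    (hJ₂ : ψ.jac q (-(k ^ 2 / (2 * l)) + 2 * l * c * Zt (proj q))
      (k + 2 * l * c * Zx (proj q)) ≠ 0) :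
    ∃ (g : ℝ) (R : ℝ × ℝ → ℝ) (Ω : Set (ℝ × ℝ)) (Ψ : ℝ × ℝ → ℝ × ℝ), g ≠ 0 ∧ IsOpen Ω ∧
      ψ.base q ∈ Ω ∧ ContDiffOn ℝ ∞ R Ω ∧ R (ψ.base q) = 0 ∧
      (fun p' => R p' - g * Z (Ψ p')) =o[𝓝 (ψ.base q)] (fun p' => Z (Ψ p')) ∧
      (dx R (ψ.base q) = 0 →
        dt R (ψ.base q) + E'.f (ψ.base q) * dx (dx R) (ψ.base q) = 0) ∧
      ∃ Ω' v', IsLocalImage ψ (hopfCole c l k q.2.2 (proj q) Z) (proj q) Ω' v' Ψ := by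
  obtain ⟨Ω₁, v₁', Ψ₁, h₁, hs₁⟩ := h.exists_localImage_hopfCole hl hE hq
    (isHeat_zero (c := c) (l := l) (k := k)) rfl (by simpa using hJ₁)
  obtain ⟨Ω₂, v₂', Ψ₂, h₂, hs₂⟩ := h.exists_localImage_hopfCole hl hE hq hZ h0 hJ₂
  set v₁ := hopfCole c l k q.2.2 (proj q) (fun _ => 0) with hv₁
  set v₂ := hopfCole c l k q.2.2 (proj q) Z with hv₂
  have hv₁q : v₁ (proj q) = q.2.2 := hopfCole_self rfl
  have hv₂q : v₂ (proj q) = q.2.2 := hopfCole_self h0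
  have hq₁ : lift v₁ (proj q) = q := by
    unfold lift
    rw [hv₁q]
    rfl
  have hq₂ : lift v₂ (proj q) = q := by
    unfold lift
    rw [hv₂q]
    rfl
  have hU : IsOpen {p | 0 < 1 + Z p} := isOpen_lt continuous_const
    (continuous_const.add hZ.smooth.continuous)
  have hv₁d : DifferentiableAt ℝ v₁ (proj q) :=
    differentiableAt_of_contDiffOn isOpen_univ
      ((isHeat_zero (c := c) (l := l) (k := k)).contDiffOn_hopfCole (Ω := Set.univ) (by simp))
      (Set.mem_univ _)
  have hv₂d : DifferentiableAt ℝ v₂ (proj q) :=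
    differentiableAt_of_contDiffOn hU (hZ.contDiffOn_hopfCole fun p hp => hp) (by simp [h0])
  obtain ⟨g, hg, hgo⟩ := h₁.exists_sub_isLittleO h₂ hv₁d hv₂d.continuousAt (hv₁q.trans hv₂q.symm)
    (mul_ne_zero (mul_ne_zero two_ne_zero hl) hc) (hopfCole_sub_isLittleO hZ.smooth h0)
  rw [hq₂] at hgo
  have hm₁ : ψ.base q ∈ Ω₁ := by simpa only [hq₁] using h₁.mem
  have hm₂ : ψ.base q ∈ Ω₂ := by simpa only [hq₂] using h₂.mem
  have he₁ : v₁' (ψ.base q) = ψ.V q := by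
    simpa only [hq₁] using h₁.eventually_eq.self_of_nhds
  have he₂ : v₂' (ψ.base q) = ψ.V q := by
    simpa only [hq₂] using h₂.eventually_eq.self_of_nhds
  refine ⟨g, fun p' => v₂' p' - v₁' p', Ω₁ ∩ Ω₂, Ψ₂, hg, h₁.isOpen.inter h₂.isOpen, ⟨hm₁, hm₂⟩,
    (h₂.smooth.mono Set.inter_subset_right).sub (h₁.smooth.mono Set.inter_subset_left), ?_, hgo,
    hs₁.dt_sub_add hs₂ h₁.isOpen h₂.isOpen hm₁ hm₂, Ω₂, v₂', h₂⟩
  simp only [he₁, he₂, sub_self]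

theorem IsLocalImage.exists_hasDerivAt_inv_hopfCole {k : ℝ} {Z Zt Zx Zxx : ℝ × ℝ → ℝ}
    {q : ℝ × ℝ × ℝ} {Ω' v' Ψ} (hZ : IsHeat c l k Z Zt Zx Zxx) (h0 : Z (proj q) = 0)
    (h : IsLocalImage ψ (hopfCole c l k q.2.2 (proj q) Z) (proj q) Ω' v' Ψ)
    {γ : ℝ → ℝ × ℝ} {s₀ : ℝ} {e' : ℝ × ℝ} (hγ : HasDerivAt γ e' s₀) (hγ0 : γ s₀ = ψ.base q) :
    Ψ (γ s₀) = proj q ∧ ∃ e : ℝ × ℝ, HasDerivAt (fun s => Ψ (γ s)) e s₀ ∧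
      e.1 * pd (1, 0, -(k ^ 2 / (2 * l)) + 2 * l * c * Zt (proj q)) ψ.T q
        + e.2 * pd (0, 1, k + 2 * l * c * Zx (proj q)) ψ.T q = e'.1 ∧
      e.1 * pd (1, 0, -(k ^ 2 / (2 * l)) + 2 * l * c * Zt (proj q)) ψ.X q
        + e.2 * pd (0, 1, k + 2 * l * c * Zx (proj q)) ψ.X q = e'.2 := by
  have hq : lift (hopfCole c l k q.2.2 (proj q) Z) (proj q) = q := by
    unfold lift
    rw [hopfCole_self h0]
    rfl
  have hU : IsOpen {p | 0 < 1 + Z p} := isOpen_lt continuous_const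
    (continuous_const.add hZ.smooth.continuous)
  have hd : DifferentiableAt ℝ (hopfCole c l k q.2.2 (proj q) Z) (proj q) :=
    differentiableAt_of_contDiffOn hU (hZ.contDiffOn_hopfCole fun p hp => hp) (by simp [h0])
  have h1 := h.inv_base
  have h2 := h.exists_hasDerivAt_inv hd hγ (by rw [hγ0, hq])
  rw [hq] at h1 h2
  rw [hZ.pd_hopfCole_t h0, hZ.pd_hopfCole_x h0] at h2
  exact ⟨by rw [hγ0, h1], h2⟩

theorem hasDerivAt_vertical (p : ℝ × ℝ) : HasDerivAt (fun y : ℝ => (p.1, y)) (0, 1) p.2 :=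
  (hasDerivAt_const _ _).prodMk (hasDerivAt_id p.2)

theorem hasDerivAt_horizontal (p : ℝ × ℝ) : HasDerivAt (fun s : ℝ => (s, p.2)) (1, 0) p.1 :=
  (hasDerivAt_id p.1).prodMk (hasDerivAt_const _ _)

/-- The function `T` depends on `t` only. The perturbation by the heat polynomial of degree four
changes the second derivatives of a solution in the direction of `t` only, while the images of
both solutions have the same second `x`-derivative, by the equation. Hence `ψ` maps the direction
of `x` along the graph to the direction of `x`. -/
theorem PointTransformation.Carries.pd_T_eq_zero (h : ψ.Carries E E') (hl : l ≠ 0)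
    (hc : c ≠ 0) (hE : ∀ p ∈ E.D, E.f p = c ∧ dx E.f p = 0 ∧ E.lam p.1 = l) {q : ℝ × ℝ × ℝ}
    (hq : q ∈ ψ.dom) : pd (0, 1, 0) ψ.T q = 0 ∧ pd (0, 0, 1) ψ.T q = 0 := by
  have key : ∀ k : ℝ, ψ.jac q (-(k ^ 2 / (2 * l))) k ≠ 0 → pd (0, 1, k) ψ.T q = 0 := by
    intro k hJ
    have hZ := isHeat_quartic (c := c) (l := l) (k := k) (p₀ := proj q)
    have h0 : heatQuartic c l k (proj q) (proj q) = 0 := by simp [heatQuartic]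
    obtain ⟨g, R, Ω, Ψ, hg, hΩ, hmem, hR, hR0, hRo, hRe, Ω', v', himg⟩ :=
      h.exists_difference hl hc hE hq hZ h0 hJ (by simpa using hJ)
    obtain ⟨hx0, e, hed, heT, heX⟩ := himg.exists_hasDerivAt_inv_hopfCole hZ h0
      (hasDerivAt_vertical (ψ.base q)) rfl
    obtain ⟨ht0, e', hed', -, -⟩ := himg.exists_hasDerivAt_inv_hopfCole hZ h0
      (hasDerivAt_horizontal (ψ.base q)) rfl
    have hdt : dt R (ψ.base q) = 0 := by
      have := tendsto_div_pow_of_isLittleO (γ := fun s => (s, (ψ.base q).2)) hRo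
        (hasDerivAt_horizontal (ψ.base q)).continuousAt
        (tendsto_heatQuartic_div hed' ht0)
      rw [mul_zero] at this
      exact (hasDerivAt_of_tendsto_div (F := fun s => R (s, (ψ.base q).2)) hR0 this).deriv
    have hdx : dx R (ψ.base q) = 0 := by
      have := tendsto_div_pow_of_isLittleO hRo (hasDerivAt_vertical (ψ.base q)).continuousAt
        (tendsto_heatQuartic_div hed hx0)
      rw [mul_zero] at this
      exact (hasDerivAt_of_tendsto_div (F := fun y => R ((ψ.base q).1, y)) hR0 this).deriv
    have hdxx := dx_dx_eq_of_tendsto hΩ hR hmem hR0 hdx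
      (tendsto_div_pow_of_isLittleO hRo (hasDerivAt_vertical (ψ.base q)).continuousAt
        (tendsto_heatQuartic_div_sq hed hx0))
    have heq := hRe hdx
    rw [hdt, zero_add, hdxx] at heq
    have hf : E'.f (ψ.base q) ≠ 0 := left_ne_zero_of_mul (E'.ne_zero _ (h.2.1 q hq))
    have he1 : e.1 = 0 := by
      have h1 := (mul_eq_zero.1 heq).resolve_left hf
      have h2 : g * (12 * c ^ 2) * e.1 ^ 2 = 0 := by linarith
      have h3 : g * (12 * c ^ 2) ≠ 0 := by positivity
      exact pow_eq_zero_iff two_ne_zero |>.1 ((mul_eq_zero.1 h2).resolve_left h3)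
    rw [he1, zero_mul, zero_add] at heT heX
    have he2 : e.2 ≠ 0 := fun h => by rw [h, zero_mul] at heX; exact zero_ne_one heX
    simpa using (mul_eq_zero.1 heT).resolve_left he2
  have hev : ∀ᶠ k : ℝ in cofinite,
      pd (0, 1, 0) ψ.T q + pd (0, 0, 1) ψ.T q * k + 0 * k ^ 2 = 0 := by
    filter_upwards [ψ.eventually_jac_ne_zero hq hl] with k hk
    have := key k hk
    rw [pd_triple] at this
    linarith
  have := coeffs_eq_zero_of_frequently hev.frequently
  exact ⟨this.1, this.2.1⟩

/-- A curve in the domain of `ψ` along which `T` is constant has a constant `t`-component, since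
`T` depends on `t` only. -/
theorem PointTransformation.eventually_fst_eq {q : ℝ × ℝ × ℝ} (hq : q ∈ ψ.dom)
    (hT : ∀ r ∈ ψ.dom, pd (0, 1, 0) ψ.T r = 0 ∧ pd (0, 0, 1) ψ.T r = 0)
    {γ : ℝ → ℝ × ℝ × ℝ} {s₀ : ℝ} (hγ : ContinuousAt γ s₀) (h0 : γ s₀ = q)
    (hγT : ∀ᶠ s in 𝓝 s₀, ψ.T (γ s) = ψ.T q) : ∀ᶠ s in 𝓝 s₀, (γ s).1 = q.1 := by
  have hTt : pd (1, 0, 0) ψ.T q ≠ 0 := by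
    intro hz
    obtain ⟨e, he, -, -⟩ := ψ.exists_direction hq 1 0 0
    rw [show e = (e.1, e.2.1, e.2.2) from rfl, pd_triple, hz, (hT q hq).1, (hT q hq).2] at he
    norm_num at he
  obtain ⟨ε, hε, hball⟩ := Metric.isOpen_iff.1 ψ.isOpen_dom q hq
  have hstrict := ((ψ.smooth_T.contDiffAt (ψ.isOpen_dom.mem_nhds hq)).hasStrictFDerivAt
    (by simp)).isLittleO
  have hγ' : Tendsto γ (𝓝 s₀) (𝓝 q) := h0 ▸ hγ
  have hγ₀ : Tendsto (fun s => (q.1, (γ s).2)) (𝓝 s₀) (𝓝 q) :=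
    tendsto_const_nhds.prodMk_nhds (continuousAt_snd.tendsto.comp hγ')
  have hcomp := hstrict.comp_tendsto (hγ'.prodMk_nhds hγ₀)
  have hsub (s : ℝ) : γ s - (q.1, (γ s).2) = ((γ s).1 - q.1) • (1, 0, 0) := by
    ext <;> simp
  have hconst : ∀ᶠ s in 𝓝 s₀, ψ.T (q.1, (γ s).2) = ψ.T q := by
    filter_upwards [hγ₀.eventually_mem (Metric.ball_mem_nhds q hε)] with s hs
    refine eq_of_pd_eq_zero ψ.isOpen_dom ψ.smooth_T (convex_ball q ε) hball
      (Metric.mem_ball_self hε) hs fun z hz => ?_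
    have : ((q.1, (γ s).2) - q : ℝ × ℝ × ℝ) = (0, (γ s).2.1 - q.2.1, (γ s).2.2 - q.2.2) := by
      ext <;> simp
    rw [this, pd_triple, (hT z (hball hz)).1, (hT z (hball hz)).2]
    ring
  -- By strict differentiability `T_t (t - t₀)` is negligible against itself, hence zero.
  have hlin : (fun s => pd (1, 0, 0) ψ.T q * ((γ s).1 - q.1)) =o[𝓝 s₀]
      fun s => pd (1, 0, 0) ψ.T q * ((γ s).1 - q.1) := by
    refine IsLittleO.trans_isBigO (g := fun s => γ s - (q.1, (γ s).2)) ?_ ?_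
    · refine (hcomp.neg_left).congr' ?_ EventuallyEq.rfl
      filter_upwards [hconst, hγT] with s hs hs'
      simp only [Function.comp_apply, hs, hs', hsub, map_smul, smul_eq_mul, pd]
      ring
    · refine IsBigO.trans (g := fun s => (γ s).1 - q.1) ?_ (isBigO_self_const_mul hTt _ _)
      refine IsBigO.of_bound 1 (Eventually.of_forall fun s => ?_)
      rw [hsub, norm_smul]
      simp [Prod.norm_def]
  by_contra hne
  refine isLittleO_irrefl ((Filter.not_eventually.1 hne).mono fun s hs => ?_) hlin
  exact mul_ne_zero hTt (sub_ne_zero.2 hs)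

/-- The function `X` does not depend on `v`, and the coefficients of the second derivatives
transform by `f' T_t = c X_x²`. This compares a linear solution with its perturbation by the heat
polynomial of degree two, which gives `f' T_t = c (X_x + k X_v)²` for infinitely many `k`. -/
theorem PointTransformation.Carries.pd_X_eq_zero (h : ψ.Carries E E') (hl : l ≠ 0)
    (hc : c ≠ 0) (hE : ∀ p ∈ E.D, E.f p = c ∧ dx E.f p = 0 ∧ E.lam p.1 = l) {q : ℝ × ℝ × ℝ}
    (hq : q ∈ ψ.dom) : pd (0, 0, 1) ψ.X q = 0 ∧
      E'.f (ψ.base q) * pd (1, 0, 0) ψ.T q = c * pd (0, 1, 0) ψ.X q ^ 2 := by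
  have hT : ∀ r ∈ ψ.dom, pd (0, 1, 0) ψ.T r = 0 ∧ pd (0, 0, 1) ψ.T r = 0 :=
    fun r hr => h.pd_T_eq_zero hl hc hE hr
  have hT1 (a : ℝ) : pd (1, 0, a) ψ.T q = pd (1, 0, 0) ψ.T q := by
    rw [pd_triple, (hT q hq).1, (hT q hq).2]
    ring
  have hT2 (b : ℝ) : pd (0, 1, b) ψ.T q = 0 := by
    rw [pd_triple, (hT q hq).1, (hT q hq).2]
    ring
  have key : ∀ k : ℝ, ψ.jac q (-(k ^ 2 / (2 * l))) k ≠ 0 →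
      E'.f (ψ.base q) * pd (1, 0, 0) ψ.T q = c * pd (0, 1, k) ψ.X q ^ 2 := by
    intro k hJ
    have hZ := isHeat_quadratic (c := c) (l := l) (k := k) (p₀ := proj q)
    have h0 : heatQuadratic c l k (proj q) (proj q) = 0 := by simp [heatQuadratic]
    have hJ' := hJ
    rw [PointTransformation.jac, hT1, hT2, zero_mul, sub_zero] at hJ'
    have hTt : pd (1, 0, 0) ψ.T q ≠ 0 := left_ne_zero_of_mul hJ'
    have hXk : pd (0, 1, k) ψ.X q ≠ 0 := right_ne_zero_of_mul hJ'
    obtain ⟨g, R, Ω, Ψ, hg, hΩ, hmem, hR, hR0, hRo, hRe, Ω', v', himg⟩ :=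
      h.exists_difference hl hc hE hq hZ h0 hJ (by
        rw [PointTransformation.jac, hT1, hT2]
        simpa using ⟨hTt, hXk⟩)
    obtain ⟨hx0, e, hed, heT, heX⟩ := himg.exists_hasDerivAt_inv_hopfCole hZ h0
      (hasDerivAt_vertical (ψ.base q)) rfl
    obtain ⟨ht0, e', hed', heT', -⟩ := himg.exists_hasDerivAt_inv_hopfCole hZ h0
      (hasDerivAt_horizontal (ψ.base q)) rfl
    rw [hT1, hT2, mul_zero, add_zero] at heT heT'
    have he1 : e.1 = 0 := (mul_eq_zero.1 heT).resolve_right hTt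
    have he2 : e.2 * pd (0, 1, k) ψ.X q = 1 := by
      rw [he1] at heX
      simpa using heX
    have hdt : dt R (ψ.base q) = g * -(2 * c * e'.1) := by
      have := tendsto_div_pow_of_isLittleO (γ := fun s => (s, (ψ.base q).2)) hRo
        (hasDerivAt_horizontal (ψ.base q)).continuousAt
        (tendsto_heatQuadratic_div hed' ht0)
      exact (hasDerivAt_of_tendsto_div (F := fun s => R (s, (ψ.base q).2)) hR0 this).deriv
    have hdx : dx R (ψ.base q) = 0 := by
      have := tendsto_div_pow_of_isLittleO hRo (hasDerivAt_vertical (ψ.base q)).continuousAt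
        (tendsto_heatQuadratic_div hed hx0)
      rw [he1, mul_zero, neg_zero, mul_zero] at this
      exact (hasDerivAt_of_tendsto_div (F := fun y => R ((ψ.base q).1, y)) hR0 this).deriv
    -- The exact equality is needed: an error of order `(y - y₀) ^ 2` in the `t`-component would
    -- contribute to the limit of `Z / (y - y₀) ^ 2`.
    have hvert : ∀ᶠ y in 𝓝 (ψ.base q).2, (Ψ ((ψ.base q).1, y)).1 = (proj q).1 := by
      have hU : IsOpen {p | 0 < 1 + heatQuadratic c l k (proj q) p} :=
        isOpen_lt continuous_const (continuous_const.add hZ.smooth.continuous)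
      have hvc : ContinuousAt (hopfCole c l k q.2.2 (proj q) (heatQuadratic c l k (proj q)))
          (proj q) := (differentiableAt_of_contDiffOn hU
            (hZ.contDiffOn_hopfCole fun p hp => hp) (by simp [h0])).continuousAt
      have hlc : ContinuousAt (lift (hopfCole c l k q.2.2 (proj q)
          (heatQuadratic c l k (proj q)))) (Ψ ((ψ.base q).1, (ψ.base q).2)) := by
        rw [hx0]
        exact continuousAt_fst.prodMk (continuousAt_snd.prodMk hvc)
      have hq' : lift (hopfCole c l k q.2.2 (proj q) (heatQuadratic c l k (proj q)))
          (proj q) = q := by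
        unfold lift
        rw [hopfCole_self h0]
        rfl
      have hmem' : ψ.base q ∈ Ω' := by simpa only [hq'] using himg.mem
      have hγ : ContinuousAt (fun y => lift (hopfCole c l k q.2.2 (proj q)
          (heatQuadratic c l k (proj q))) (Ψ ((ψ.base q).1, y))) (ψ.base q).2 :=
        ContinuousAt.comp (g := lift (hopfCole c l k q.2.2 (proj q)
          (heatQuadratic c l k (proj q)))) hlc hed.continuousAt
      refine ψ.eventually_fst_eq hq hT hγ ?_ ?_
      · rw [hx0, hq']
      · filter_upwards [eventually_slice_mem himg.isOpen hmem'] with y hy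
        exact congrArg (fun z : ℝ × ℝ => z.1) (himg.base_inv _ hy)
    have hdxx := dx_dx_eq_of_tendsto hΩ hR hmem hR0 hdx
      (tendsto_div_pow_of_isLittleO hRo (hasDerivAt_vertical (ψ.base q)).continuousAt
        (tendsto_heatQuadratic_div_sq hed hx0 hvert))
    have heq := hRe hdx
    rw [hdt, hdxx] at heq
    have h1 : E'.f (ψ.base q) * e.2 ^ 2 = c * e'.1 := by
      have : (2 * g) * (E'.f (ψ.base q) * e.2 ^ 2 - c * e'.1) = 0 := by linarith
      have := (mul_eq_zero.1 this).resolve_left (mul_ne_zero two_ne_zero hg)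
      linarith
    simp only at heT'
    linear_combination (pd (0, 1, k) ψ.X q ^ 2 * pd (1, 0, 0) ψ.T q) * h1
      - E'.f (ψ.base q) * pd (1, 0, 0) ψ.T q * (e.2 * pd (0, 1, k) ψ.X q + 1) * he2
      + c * pd (0, 1, k) ψ.X q ^ 2 * heT'
  have hev : ∀ᶠ k : ℝ in cofinite,
      (c * pd (0, 1, 0) ψ.X q ^ 2 - E'.f (ψ.base q) * pd (1, 0, 0) ψ.T q)
        + 2 * c * pd (0, 1, 0) ψ.X q * pd (0, 0, 1) ψ.X q * k
        + c * pd (0, 0, 1) ψ.X q ^ 2 * k ^ 2 = 0 := by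
    filter_upwards [ψ.eventually_jac_ne_zero hq hl] with k hk
    have := key k hk
    rw [pd_triple ψ.X q 0 1 k] at this
    linarith
  obtain ⟨h1, -, h3⟩ := coeffs_eq_zero_of_frequently hev.frequently
  refine ⟨pow_eq_zero_iff two_ne_zero |>.1 ((mul_eq_zero.1 h3).resolve_left hc), by linarith⟩

end

/-! ### The determining equations and their compatibility -/

section

variable {ψ : PointTransformation} {E E' : PotEq} {c l : ℝ}

theorem PointTransformation.hasDerivAt_comp_base {q e : ℝ × ℝ × ℝ} (hq : q ∈ ψ.dom)
    {w : ℝ × ℝ → ℝ} (hw : DifferentiableAt ℝ w (ψ.base q)) :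
    HasDerivAt (fun s : ℝ => w (ψ.base (q + s • e)))
      (pd e ψ.T q * pd (1, 0) w (ψ.base q) + pd e ψ.X q * pd (0, 1) w (ψ.base q)) 0 := by
  have h1 : HasDerivAt (fun s : ℝ => ψ.base (q + s • e)) (pd e ψ.T q, pd e ψ.X q) 0 :=
    (hasDerivAt_pd ψ.isOpen_dom ψ.smooth_T hq e).prodMk
      (hasDerivAt_pd ψ.isOpen_dom ψ.smooth_X hq e)
  rw [← pd_pair]
  have h0 : q + (0 : ℝ) • e = q := by simp
  have := hasDerivAt_comp_pd (F := w) (γ := fun s : ℝ => ψ.base (q + s • e)) (by rwa [h0]) h1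
  rwa [h0] at this

/-- The functions `T_t`, `X_x`, `V_v` have no zeros once `T = T(t)` and `X = X(t, x)`. -/
theorem PointTransformation.Carries.ne_zero (h : ψ.Carries E E') (hl : l ≠ 0)
    (hc : c ≠ 0) (hE : ∀ p ∈ E.D, E.f p = c ∧ dx E.f p = 0 ∧ E.lam p.1 = l) {q : ℝ × ℝ × ℝ}
    (hq : q ∈ ψ.dom) : pd (1, 0, 0) ψ.T q ≠ 0 ∧ pd (0, 1, 0) ψ.X q ≠ 0 ∧
      pd (0, 0, 1) ψ.V q ≠ 0 := by
  obtain ⟨hTx, hTv⟩ := h.pd_T_eq_zero hl hc hE hq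
  obtain ⟨hXv, hfX⟩ := h.pd_X_eq_zero hl hc hE hq
  have hTt : pd (1, 0, 0) ψ.T q ≠ 0 := by
    intro hz
    obtain ⟨e, he, -, -⟩ := ψ.exists_direction hq 1 0 0
    rw [show e = (e.1, e.2.1, e.2.2) from rfl, pd_triple, hz, hTx, hTv] at he
    norm_num at he
  refine ⟨hTt, fun hz => ?_, fun hz => ?_⟩
  · have hf : E'.f (ψ.base q) ≠ 0 := left_ne_zero_of_mul (E'.ne_zero _ (h.2.1 q hq))
    rw [hz] at hfX
    exact mul_ne_zero hf hTt (by rw [hfX]; ring)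
  · have := ψ.direction_eq_zero hq hTv hXv hz
    simp at this

/-- The equation for the image of the linear solution with slope `k` through `q`, in terms of the
derivatives `α`, `ξ`, `η` (the `t`-, `x`- and second `x`-derivative) of this image. -/
theorem PointTransformation.Carries.exists_image_derivatives (h : ψ.Carries E E') (hl : l ≠ 0)
    (hc : c ≠ 0) (hE : ∀ p ∈ E.D, E.f p = c ∧ dx E.f p = 0 ∧ E.lam p.1 = l) {q : ℝ × ℝ × ℝ}
    (hq : q ∈ ψ.dom) (k : ℝ) : ∃ α ξ η : ℝ,
      α + 1 / (2 * E'.lam (ψ.T q)) * ξ ^ 2 + E'.f (ψ.base q) * η - dx E'.f (ψ.base q) * ξ = 0 ∧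
      pd (1, 0, 0) ψ.T q * α + pd (1, 0, 0) ψ.X q * ξ =
        pd (1, 0, 0) ψ.V q - k ^ 2 / (2 * l) * pd (0, 0, 1) ψ.V q ∧
      pd (0, 1, 0) ψ.X q * ξ = pd (0, 1, 0) ψ.V q + k * pd (0, 0, 1) ψ.V q ∧
      pd (0, 1, 0) ψ.X q ^ 2 * η + pd (0, 1, 0) (pd (0, 1, 0) ψ.X) q * ξ =
        pd (0, 1, 0) (pd (0, 1, 0) ψ.V) q + 2 * k * pd (0, 1, 0) (pd (0, 0, 1) ψ.V) q
          + k ^ 2 * pd (0, 0, 1) (pd (0, 0, 1) ψ.V) q := by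
  have hT := fun r hr => h.pd_T_eq_zero hl hc hE (q := r) hr
  have hXv := fun r hr => (h.pd_X_eq_zero hl hc hE (q := r) hr).1
  have hdom := ψ.isOpen_dom
  obtain ⟨hTt, hXx, -⟩ := h.ne_zero hl hc hE hq
  have hTk (r) (hr : r ∈ ψ.dom) (a b d : ℝ) : pd (a, b, d) ψ.T r = a * pd (1, 0, 0) ψ.T r := by
    rw [pd_triple, (hT r hr).1, (hT r hr).2]
    ring
  have hXk (r) (hr : r ∈ ψ.dom) (a b d : ℝ) :
      pd (a, b, d) ψ.X r = a * pd (1, 0, 0) ψ.X r + b * pd (0, 1, 0) ψ.X r := by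
    rw [pd_triple, hXv r hr]
    ring
  obtain ⟨Ω', v', Ψ, himg, hsol⟩ := h.exists_localImage_hopfCole hl hE hq
    (isHeat_zero (c := c) (l := l) (k := k)) rfl (by
      rw [PointTransformation.jac, hTk q hq 1, hTk q hq 0, hXk q hq 0, hXk q hq 1]
      simpa only [one_mul, zero_mul, add_zero, zero_add, sub_zero] using mul_ne_zero hTt hXx)
  set v := hopfCole c l k q.2.2 (proj q) (fun _ => 0) with hv
  have hvp (p : ℝ × ℝ) :
      v p = q.2.2 + k * (p.2 - q.2.1) - k ^ 2 / (2 * l) * (p.1 - q.1) := by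
    simp [hv, hopfCole, proj]
  have hq' : lift v (proj q) = q := by
    unfold lift
    rw [hvp]
    simp [proj]
  have hm : ψ.base q ∈ Ω' := by simpa only [hq'] using himg.mem
  -- The graph of the linear solution is an affine plane, so its restrictions to lines are lines.
  have hline (a b : ℝ) : ∀ᶠ s : ℝ in 𝓝 0,
      ψ.base (q + s • (a, b, k * b - k ^ 2 / (2 * l) * a)) ∈ Ω' ∧
      v' (ψ.base (q + s • (a, b, k * b - k ^ 2 / (2 * l) * a)))
        = ψ.V (q + s • (a, b, k * b - k ^ 2 / (2 * l) * a)) := by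
    have hcont : Tendsto (fun s : ℝ => proj q + s • (a, b)) (𝓝 0) (𝓝 (proj q)) := by
      have : ContinuousAt (fun s : ℝ => proj q + s • (a, b)) 0 := by fun_prop
      simpa [ContinuousAt] using this
    filter_upwards [hcont.eventually himg.eventually_mem, hcont.eventually himg.eventually_eq]
      with s h1 h2
    have hs : lift v (proj q + s • (a, b)) = q + s • (a, b, k * b - k ^ 2 / (2 * l) * a) := by
      unfold lift
      rw [hvp]
      ext
      · simp [proj]
      · simp [proj]
      · simp [proj]
        ring
    rw [hs] at h1 h2
    exact ⟨h1, h2⟩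
  have hv'd : ∀ p ∈ Ω', DifferentiableAt ℝ v' p :=
    fun p hp => differentiableAt_of_contDiffOn himg.isOpen himg.smooth hp
  have hw := contDiffOn_pd himg.isOpen himg.smooth (0, 1)
  have hwd := differentiableAt_of_contDiffOn himg.isOpen hw hm
  have hVx := contDiffOn_pd hdom ψ.smooth_V (0, 1, 0)
  have hVv := contDiffOn_pd hdom ψ.smooth_V (0, 0, 1)
  have hXxs := contDiffOn_pd hdom ψ.smooth_X (0, 1, 0)
  refine ⟨pd (1, 0) v' (ψ.base q), pd (0, 1) v' (ψ.base q),
    pd (0, 1) (pd (0, 1) v') (ψ.base q), ?_, ?_, ?_, ?_⟩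
  · have := hsol.2 _ hm
    rwa [dt_eq_pd (hv'd _ hm), dx_eq_pd (hv'd _ hm),
      dx_dx_eq_pd himg.isOpen himg.smooth hm] at this
  · have h1 := ψ.hasDerivAt_comp_base (e := (1, 0, k * 0 - k ^ 2 / (2 * l) * 1)) hq (hv'd _ hm)
    have h2 := hasDerivAt_pd hdom ψ.smooth_V hq (1, 0, k * 0 - k ^ 2 / (2 * l) * 1)
    have h3 := h1.unique (h2.congr_of_eventuallyEq ((hline 1 0).mono fun s hs => hs.2))
    rw [hTk q hq, hXk q hq, pd_triple ψ.V] at h3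
    linarith
  · have h1 := ψ.hasDerivAt_comp_base (e := (0, 1, k * 1 - k ^ 2 / (2 * l) * 0)) hq (hv'd _ hm)
    have h2 := hasDerivAt_pd hdom ψ.smooth_V hq (0, 1, k * 1 - k ^ 2 / (2 * l) * 0)
    have h3 := h1.unique (h2.congr_of_eventuallyEq ((hline 0 1).mono fun s hs => hs.2))
    rw [hTk q hq, hXk q hq, pd_triple ψ.V] at h3
    linarith
  · set e : ℝ × ℝ × ℝ := (0, 1, k * 1 - k ^ 2 / (2 * l) * 0) with he
    have hek : e = (0, 1, k) := by rw [he]; simp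
    have hfirst : ∀ᶠ s : ℝ in 𝓝 0, pd (0, 1) v' (ψ.base (q + s • e))
        * pd (0, 1, 0) ψ.X (q + s • e) =
          pd (0, 1, 0) ψ.V (q + s • e) + k * pd (0, 0, 1) ψ.V (q + s • e) := by
      filter_upwards [(hline 0 1).eventually_nhds, eventually_line_mem hdom hq e] with s hs hsd
      have hadd (r : ℝ) : q + s • e + r • e = q + (s + r) • e := by
        rw [add_smul, add_assoc]
      have ht : Tendsto (fun r : ℝ => s + r) (𝓝 0) (𝓝 s) := by
        have : ContinuousAt (fun r : ℝ => s + r) 0 := by fun_prop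
        simpa [ContinuousAt] using this
      have h1 := ψ.hasDerivAt_comp_base (e := e) hsd (hv'd _ hs.self_of_nhds.1)
      have h2 := hasDerivAt_pd hdom ψ.smooth_V hsd e
      have h3 := h1.unique (h2.congr_of_eventuallyEq ((ht.eventually hs).mono fun r hr => by
        simp only [hadd]
        exact hr.2))
      rw [hek, hTk _ (hek ▸ hsd), hXk _ (hek ▸ hsd), pd_triple ψ.V] at h3
      rw [hek]
      linarith
    have hL := (ψ.hasDerivAt_comp_base (e := e) hq hwd).mul (hasDerivAt_pd hdom hXxs hq e)
    have hR := (hasDerivAt_pd hdom hVx hq e).add ((hasDerivAt_pd hdom hVv hq e).const_mul k)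
    have h3 := hL.unique (hR.congr_of_eventuallyEq hfirst)
    have hXxv : pd (0, 0, 1) (pd (0, 1, 0) ψ.X) q = 0 := by
      rw [pd_comm hdom ψ.smooth_X hq]
      exact pd_eq_zero hdom hXv hq _
    rw [hek, hTk q hq, hXk q hq, pd_triple (pd (0, 1, 0) ψ.X), hXxv,
      pd_triple (pd (0, 1, 0) ψ.V), pd_triple (pd (0, 0, 1) ψ.V),
      pd_comm hdom ψ.smooth_V hq (0, 0, 1) (0, 1, 0)] at h3
    simp only [zero_smul, add_zero] at h3
    linarith

/-- The function `1 / (λ' f')` of the target equation, pulled back by the point transformation. -/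
noncomputable def pullbackM (ψ : PointTransformation) (E' : PotEq) (q : ℝ × ℝ × ℝ) : ℝ :=
  (E'.lam (ψ.T q) * E'.f (ψ.base q))⁻¹

/-- The coefficient of the first `x`-derivative in the target equation, after the change of
variables from `(T, X)` to `(t, x)` and multiplication by `T_t`. -/
noncomputable def pullbackB (ψ : PointTransformation) (E' : PotEq) (c : ℝ) (q : ℝ × ℝ × ℝ) : ℝ :=
  -(pd (1, 0, 0) ψ.X q + c * pd (0, 1, 0) (pd (0, 1, 0) ψ.X) q
    + dx E'.f (ψ.base q) * pd (1, 0, 0) ψ.T q) / pd (0, 1, 0) ψ.X q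

/-- The coefficients of `1`, `v_x` and `v_x²` in the transformed equation. -/
theorem PointTransformation.Carries.determining_equations (h : ψ.Carries E E') (hl : l ≠ 0)
    (hc : c ≠ 0) (hE : ∀ p ∈ E.D, E.f p = c ∧ dx E.f p = 0 ∧ E.lam p.1 = l) {q : ℝ × ℝ × ℝ}
    (hq : q ∈ ψ.dom) :
    (pd (1, 0, 0) ψ.V q + pullbackB ψ E' c q * pd (0, 1, 0) ψ.V q
      + c / 2 * pullbackM ψ E' q * pd (0, 1, 0) ψ.V q ^ 2
      + c * pd (0, 1, 0) (pd (0, 1, 0) ψ.V) q = 0) ∧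
    (pullbackB ψ E' c q * pd (0, 0, 1) ψ.V q
      + c * pullbackM ψ E' q * pd (0, 1, 0) ψ.V q * pd (0, 0, 1) ψ.V q
      + 2 * c * pd (0, 1, 0) (pd (0, 0, 1) ψ.V) q = 0) ∧
    (-(1 / (2 * l)) * pd (0, 0, 1) ψ.V q + c / 2 * pullbackM ψ E' q * pd (0, 0, 1) ψ.V q ^ 2
      + c * pd (0, 0, 1) (pd (0, 0, 1) ψ.V) q = 0) := by
  obtain ⟨hTt, hXx, -⟩ := h.ne_zero hl hc hE hq
  have hfX := (h.pd_X_eq_zero hl hc hE hq).2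
  have hne := E'.ne_zero _ (h.2.1 q hq)
  have hf : E'.f (ψ.base q) ≠ 0 := left_ne_zero_of_mul hne
  have hlam : E'.lam (ψ.T q) ≠ 0 := right_ne_zero_of_mul hne
  refine coeffs_eq_zero_of_frequently (Eventually.frequently (Eventually.of_forall fun k => ?_))
  obtain ⟨α, ξ, η, h1, h2, h3, h4⟩ := h.exists_image_derivatives hl hc hE hq k
  rw [pullbackB, pullbackM]
  set Tt := pd (1, 0, 0) ψ.T q
  set Xt := pd (1, 0, 0) ψ.X q
  set Xx := pd (0, 1, 0) ψ.X q
  set Xxx := pd (0, 1, 0) (pd (0, 1, 0) ψ.X) q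
  set f := E'.f (ψ.base q)
  set g := dx E'.f (ψ.base q)
  set L := E'.lam (ψ.T q)
  set Vt := pd (1, 0, 0) ψ.V q
  set Vx := pd (0, 1, 0) ψ.V q
  set Vv := pd (0, 0, 1) ψ.V q
  set Vxx := pd (0, 1, 0) (pd (0, 1, 0) ψ.V) q
  set Vxv := pd (0, 1, 0) (pd (0, 0, 1) ψ.V) q
  set Vvv := pd (0, 0, 1) (pd (0, 0, 1) ψ.V) q
  have hB : -(Xt + c * Xxx + g * Tt) / Xx * (Vx + k * Vv) = -(Xt + c * Xxx + g * Tt) * ξ := by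
    rw [← h3]
    field_simp
  have hM : c / 2 * (L * f)⁻¹ * (Vx + k * Vv) ^ 2 = Tt * (1 / (2 * L) * ξ ^ 2) := by
    rw [← h3]
    field_simp
    linear_combination (-ξ ^ 2) * hfX
  linear_combination hB + hM - h2 - c * h4 + Tt * h1 - η * hfX

/-- The coefficients of the transformed equation do not depend on `v`. -/
theorem PointTransformation.Carries.eventually_coeff_eq (h : ψ.Carries E E') (hl : l ≠ 0)
    (hc : c ≠ 0) (hE : ∀ p ∈ E.D, E.f p = c ∧ dx E.f p = 0 ∧ E.lam p.1 = l) {q : ℝ × ℝ × ℝ}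
    (hq : q ∈ ψ.dom) : ∀ᶠ s : ℝ in 𝓝 0,
      pullbackM ψ E' (q + s • (0, 0, 1)) = pullbackM ψ E' q ∧
      pullbackB ψ E' c (q + s • (0, 0, 1)) = pullbackB ψ E' c q := by
  have hdom := ψ.isOpen_dom
  have hTv := fun r hr => (h.pd_T_eq_zero hl hc hE (q := r) hr).2
  have hXv := fun r hr => (h.pd_X_eq_zero hl hc hE (q := r) hr).1
  have hXts := contDiffOn_pd hdom ψ.smooth_X (1, 0, 0)
  have hXxs := contDiffOn_pd hdom ψ.smooth_X (0, 1, 0)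
  have hTts := contDiffOn_pd hdom ψ.smooth_T (1, 0, 0)
  have hXxv : ∀ r ∈ ψ.dom, pd (0, 0, 1) (pd (0, 1, 0) ψ.X) r = 0 := fun r hr => by
    rw [pd_comm hdom ψ.smooth_X hr]
    exact pd_eq_zero hdom hXv hr _
  have hXtv : ∀ r ∈ ψ.dom, pd (0, 0, 1) (pd (1, 0, 0) ψ.X) r = 0 := fun r hr => by
    rw [pd_comm hdom ψ.smooth_X hr]
    exact pd_eq_zero hdom hXv hr _
  have hTtv : ∀ r ∈ ψ.dom, pd (0, 0, 1) (pd (1, 0, 0) ψ.T) r = 0 := fun r hr => by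
    rw [pd_comm hdom ψ.smooth_T hr]
    exact pd_eq_zero hdom hTv hr _
  have hXxxv : ∀ r ∈ ψ.dom, pd (0, 0, 1) (pd (0, 1, 0) (pd (0, 1, 0) ψ.X)) r = 0 := fun r hr => by
    rw [pd_comm hdom hXxs hr]
    exact pd_eq_zero hdom hXxv hr _
  obtain ⟨ε, hε, hball⟩ := Metric.isOpen_iff.1 hdom q hq
  filter_upwards [eventually_line_mem Metric.isOpen_ball (Metric.mem_ball_self (x := q) hε)
    (0, 0, 1)]
    with s hs
  have key {F : ℝ × ℝ × ℝ → ℝ} (hF : ContDiffOn ℝ ∞ F ψ.dom)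
      (hFv : ∀ r ∈ ψ.dom, pd (0, 0, 1) F r = 0) : F (q + s • (0, 0, 1)) = F q := by
    refine eq_of_pd_eq_zero hdom hF (convex_ball q ε) hball (Metric.mem_ball_self hε) hs
      fun z hz => ?_
    have : q + s • ((0, 0, 1) : ℝ × ℝ × ℝ) - q = (0, 0, s) := by simp
    rw [this, pd_triple, hFv z (hball hz)]
    ring
  have hbase : ψ.base (q + s • (0, 0, 1)) = ψ.base q :=
    Prod.ext (key ψ.smooth_T hTv) (key ψ.smooth_X hXv)
  constructor
  · rw [pullbackM, pullbackM, hbase, key ψ.smooth_T hTv]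
  · rw [pullbackB, pullbackB, hbase, key hXts hXtv, key hXxs hXxv, key hTts hTtv,
      key (contDiffOn_pd hdom hXxs _) hXxxv]

/-- The derivative of `λ' f' = 1 / M`, pulled back, along a line. -/
theorem PointTransformation.Carries.hasDerivAt_inv_pullbackM (h : ψ.Carries E E')
    {q : ℝ × ℝ × ℝ} (hq : q ∈ ψ.dom) (e : ℝ × ℝ × ℝ) :
    HasDerivAt (fun s : ℝ => E'.lam (ψ.T (q + s • e)) * E'.f (ψ.base (q + s • e)))
      (deriv E'.lam (ψ.T q) * pd e ψ.T q * E'.f (ψ.base q) + E'.lam (ψ.T q)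
        * (pd e ψ.T q * pd (1, 0) E'.f (ψ.base q) + pd e ψ.X q * pd (0, 1) E'.f (ψ.base q))) 0 := by
  have hm := h.2.1 q hq
  have hlam : DifferentiableAt ℝ E'.lam (ψ.T q) := differentiableAt_of_contDiffOn
    (isOpenMap_fst _ E'.isOpen_D) E'.smooth_lam ⟨_, hm, rfl⟩
  have h0 : q + (0 : ℝ) • e = q := by simp
  have h1 : HasDerivAt (fun s : ℝ => E'.lam (ψ.T (q + s • e)))
      (deriv E'.lam (ψ.T q) * pd e ψ.T q) 0 := by
    refine HasDerivAt.comp (h₂ := E'.lam) (0 : ℝ) ?_ (hasDerivAt_pd ψ.isOpen_dom ψ.smooth_T hq e)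
    rw [h0]
    exact hlam.hasDerivAt
  have h2 := h1.fun_mul (ψ.hasDerivAt_comp_base (e := e) hq
    (differentiableAt_of_contDiffOn E'.isOpen_D E'.smooth_f hm))
  simpa only [h0] using h2

theorem PointTransformation.Carries.contDiffOn_pullbackM (h : ψ.Carries E E') :
    ContDiffOn ℝ ∞ (pullbackM ψ E') ψ.dom := by
  refine ContDiffOn.inv (ContDiffOn.mul ?_ ?_) ?_
  · exact E'.smooth_lam.comp ψ.smooth_T fun q hq => ⟨_, h.2.1 q hq, rfl⟩
  · exact E'.smooth_f.comp ψ.contDiffOn_base fun q hq => h.2.1 q hq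
  · intro q hq
    rw [mul_comm]
    exact E'.ne_zero _ (h.2.1 q hq)

/-- The function `M = 1 / (λ' f')`, pulled back, is locally constant. With `p = V_v` the
determining equations read `V_t + B V_x + (c / 2) M V_x² + c V_xx = 0`,
`B p + c M V_x p + 2 c p_x = 0` and `c p_v = p / (2 l) - (c / 2) M p²`, where `M` and `B` are
functions of `(t, x)`. The compatibility of the last two is `M_x p³ = 0`. The `v`-derivative of the
first and the second together give `p p_t + c p p_xx = 2 c p_x²`, whose compatibility with the
third is `M_t p³ = 0`. -/
theorem PointTransformation.Carries.pd_pullbackM_eq_zero (h : ψ.Carries E E') (hl : l ≠ 0)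
    (hc : c ≠ 0) (hE : ∀ p ∈ E.D, E.f p = c ∧ dx E.f p = 0 ∧ E.lam p.1 = l) {q : ℝ × ℝ × ℝ}
    (hq : q ∈ ψ.dom) : pd (0, 1, 0) (pullbackM ψ E') q = 0 ∧
      pd (1, 0, 0) (pullbackM ψ E') q = 0 := by
  have hdom := ψ.isOpen_dom
  have hdet := fun r hr => h.determining_equations hl hc hE (q := r) hr
  have hpne := fun r hr => (h.ne_zero hl hc hE (q := r) hr).2.2
  have hcoeff := fun r hr => h.eventually_coeff_eq hl hc hE (q := r) hr
  have hMs := h.contDiffOn_pullbackM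
  set M := pullbackM ψ E'
  set B := pullbackB ψ E' c
  have hVt := contDiffOn_pd hdom ψ.smooth_V (1, 0, 0)
  have hVx := contDiffOn_pd hdom ψ.smooth_V (0, 1, 0)
  have hVxx := contDiffOn_pd hdom hVx (0, 1, 0)
  have hps := contDiffOn_pd hdom ψ.smooth_V (0, 0, 1)
  have hcomm_t : ∀ r ∈ ψ.dom,
      pd (0, 0, 1) (pd (1, 0, 0) ψ.V) r = pd (1, 0, 0) (pd (0, 0, 1) ψ.V) r :=
    fun r hr => pd_comm hdom ψ.smooth_V hr _ _
  have hcomm_x : ∀ r ∈ ψ.dom,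
      pd (0, 0, 1) (pd (0, 1, 0) ψ.V) r = pd (0, 1, 0) (pd (0, 0, 1) ψ.V) r :=
    fun r hr => pd_comm hdom ψ.smooth_V hr _ _
  have hcomm_xx : ∀ r ∈ ψ.dom, pd (0, 0, 1) (pd (0, 1, 0) (pd (0, 1, 0) ψ.V)) r
      = pd (0, 1, 0) (pd (0, 1, 0) (pd (0, 0, 1) ψ.V)) r := fun r hr => by
    rw [pd_comm hdom hVx hr, pd_congr hdom hcomm_x hr]
  set p := pd (0, 0, 1) ψ.V
  have hpx := contDiffOn_pd hdom hps (0, 1, 0)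
  have hpt := contDiffOn_pd hdom hps (1, 0, 0)
  have hpv := contDiffOn_pd hdom hps (0, 0, 1)
  have hpxx := contDiffOn_pd hdom hpx (0, 1, 0)
  have hpvx := contDiffOn_pd hdom hpv (0, 1, 0)
  have hDt {F : ℝ × ℝ × ℝ → ℝ} (hF : ContDiffOn ℝ ∞ F ψ.dom) {r} (hr : r ∈ ψ.dom) (e) :=
    hasDerivAt_pd hdom hF hr e
  -- The derivatives of the third equation in the directions of `x` and `t`.
  have h3 (e : ℝ × ℝ × ℝ) : ∀ r ∈ ψ.dom, -(1 / (2 * l)) * pd e p r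
      + c / 2 * (pd e M r * p r ^ 2 + 2 * M r * p r * pd e p r)
      + c * pd e (pd (0, 0, 1) p) r = 0 := by
    intro r hr
    have hd := (((hDt hps hr e).const_mul (-(1 / (2 * l)))).add
      (((hDt hMs hr e).const_mul (c / 2)).mul ((hDt hps hr e).fun_pow 2))).add
      ((hDt hpv hr e).const_mul c)
    have := eq_zero_of_hasDerivAt_line hdom hr (R := fun r => -(1 / (2 * l)) * p r
      + c / 2 * M r * p r ^ 2 + c * pd (0, 0, 1) p r) (fun z hz => (hdet z hz).2.2) hd
    simp only [zero_smul, add_zero, Nat.cast_ofNat, Nat.reduceSub, pow_one] at this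
    linear_combination this
  have hMx : ∀ r ∈ ψ.dom, pd (0, 1, 0) M r = 0 := by
    intro r hr
    have e2 := (hdet r hr).2.1
    have e3 := (hdet r hr).2.2
    have e3x := h3 (0, 1, 0) r hr
    -- The `v`-derivative of the second equation; `M` and `B` are constant along the line.
    have e2v : B r * pd (0, 0, 1) p r + c * M r * (pd (0, 1, 0) p r * p r
        + pd (0, 1, 0) ψ.V r * pd (0, 0, 1) p r) + 2 * c * pd (0, 1, 0) (pd (0, 0, 1) p) r = 0 := by
      have hd := (((hDt hps hr (0, 0, 1)).const_mul (B r)).add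
        (((hDt hVx hr (0, 0, 1)).const_mul (c * M r)).mul (hDt hps hr (0, 0, 1)))).add
        ((hDt hpx hr (0, 0, 1)).const_mul (2 * c))
      have h0 : HasDerivAt (fun _ : ℝ => (0 : ℝ)) 0 0 := hasDerivAt_const _ _
      have := hd.unique (h0.congr_of_eventuallyEq (by
        filter_upwards [hcoeff r hr, eventually_line_mem hdom hr (0, 0, 1)] with s hs hsd
        have := (hdet _ hsd).2.1
        rw [hs.1, hs.2] at this
        exact this))
      simp only [zero_smul, add_zero] at this
      rw [hcomm_x r hr, pd_comm hdom hps hr (0, 0, 1) (0, 1, 0)] at this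
      linear_combination this
    have hfin : (c * p r ^ 3) * pd (0, 1, 0) M r = 0 := by
      linear_combination 2 * p r * e3x - p r * e2v + pd (0, 0, 1) p r * e2
        - 2 * pd (0, 1, 0) p r * e3
    exact (mul_eq_zero.1 hfin).resolve_left (mul_ne_zero hc (pow_ne_zero 3 (hpne r hr)))
  refine ⟨hMx q hq, ?_⟩
  have h4 : ∀ r ∈ ψ.dom, p r * pd (1, 0, 0) p r + c * (p r * pd (0, 1, 0) (pd (0, 1, 0) p) r)
      - 2 * c * pd (0, 1, 0) p r ^ 2 = 0 := by
    intro r hr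
    have e2 := (hdet r hr).2.1
    -- The `v`-derivative of the first equation.
    have e1v : pd (1, 0, 0) p r + B r * pd (0, 1, 0) p r
        + c * M r * pd (0, 1, 0) ψ.V r * pd (0, 1, 0) p r
        + c * pd (0, 1, 0) (pd (0, 1, 0) p) r = 0 := by
      have hd := (((hDt hVt hr (0, 0, 1)).add ((hDt hVx hr (0, 0, 1)).const_mul (B r))).add
        (((hDt hVx hr (0, 0, 1)).fun_pow 2).const_mul (c / 2 * M r))).add
        ((hDt hVxx hr (0, 0, 1)).const_mul c)
      have h0 : HasDerivAt (fun _ : ℝ => (0 : ℝ)) 0 0 := hasDerivAt_const _ _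
      have := hd.unique (h0.congr_of_eventuallyEq (by
        filter_upwards [hcoeff r hr, eventually_line_mem hdom hr (0, 0, 1)] with s hs hsd
        have := (hdet _ hsd).1
        rw [hs.1, hs.2] at this
        exact this))
      simp only [zero_smul, add_zero, Nat.cast_ofNat, Nat.reduceSub, pow_one] at this
      rw [hcomm_x r hr, hcomm_t r hr, hcomm_xx r hr] at this
      linear_combination this
    linear_combination p r * e1v - pd (0, 1, 0) p r * e2
  have e4 := h4 q hq
  have e3 := (hdet q hq).2.2
  have e3t := h3 (1, 0, 0) q hq
  have e3x := h3 (0, 1, 0) q hq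
  have e4v : pd (0, 0, 1) p q * pd (1, 0, 0) p q + p q * pd (1, 0, 0) (pd (0, 0, 1) p) q
      + c * (pd (0, 0, 1) p q * pd (0, 1, 0) (pd (0, 1, 0) p) q
        + p q * pd (0, 1, 0) (pd (0, 1, 0) (pd (0, 0, 1) p)) q)
      - 4 * c * pd (0, 1, 0) p q * pd (0, 1, 0) (pd (0, 0, 1) p) q = 0 := by
    have hd := (((hDt hps hq (0, 0, 1)).mul (hDt hpt hq (0, 0, 1))).add
      (((hDt hps hq (0, 0, 1)).mul (hDt hpxx hq (0, 0, 1))).const_mul c)).sub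
      (((hDt hpx hq (0, 0, 1)).fun_pow 2).const_mul (2 * c))
    have := eq_zero_of_hasDerivAt_line hdom hq (R := fun r => p r * pd (1, 0, 0) p r
      + c * (p r * pd (0, 1, 0) (pd (0, 1, 0) p) r) - 2 * c * pd (0, 1, 0) p r ^ 2) h4 hd
    simp only [zero_smul, add_zero, Nat.cast_ofNat, Nat.reduceSub, pow_one] at this
    rw [pd_comm hdom hps hq (0, 0, 1) (1, 0, 0), pd_comm hdom hpx hq (0, 0, 1) (0, 1, 0),
      pd_congr hdom (fun r hr => pd_comm hdom hps hr (0, 0, 1) (0, 1, 0)) hq,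
      pd_comm hdom hps hq (0, 0, 1) (0, 1, 0)] at this
    linear_combination this
  have e3xx : -(1 / (2 * l)) * pd (0, 1, 0) (pd (0, 1, 0) p) q
      + c * M q * (pd (0, 1, 0) p q ^ 2 + p q * pd (0, 1, 0) (pd (0, 1, 0) p) q)
      + c * pd (0, 1, 0) (pd (0, 1, 0) (pd (0, 0, 1) p)) q = 0 := by
    have hd := (((hDt hpx hq (0, 1, 0)).const_mul (-(1 / (2 * l)))).add
      ((((hDt hMs hq (0, 1, 0)).const_mul c).fun_mul (hDt hps hq (0, 1, 0))).mul
        (hDt hpx hq (0, 1, 0)))).add ((hDt hpvx hq (0, 1, 0)).const_mul c)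
    have := eq_zero_of_hasDerivAt_line hdom hq (R := fun r => -(1 / (2 * l)) * pd (0, 1, 0) p r
      + c * M r * p r * pd (0, 1, 0) p r + c * pd (0, 1, 0) (pd (0, 0, 1) p) r)
      (fun z hz => by
        have := h3 (0, 1, 0) z hz
        rw [hMx z hz] at this
        linear_combination this) hd
    simp only [zero_smul, add_zero, hMx q hq] at this
    linear_combination this
  rw [hMx q hq] at e3x
  have hfin : (c / 2 * p q ^ 3) * pd (1, 0, 0) M q = 0 := by
    linear_combination -c * e4v + (pd (1, 0, 0) p q + c * pd (0, 1, 0) (pd (0, 1, 0) p) q) * e3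
      + p q * e3t + c * p q * e3xx - 4 * c * pd (0, 1, 0) p q * e3x
      + (1 / l - 3 / 2 * c * M q * p q) * e4
  exact (mul_eq_zero.1 hfin).resolve_left
    (mul_ne_zero (by positivity) (pow_ne_zero 3 (hpne q hq)))

/-- At every point of the image, `f'` has zero derivatives. -/
theorem PointTransformation.Carries.target_derivatives (h : ψ.Carries E E') (hconst : E.FConst)
    {q : ℝ × ℝ × ℝ} (hq : q ∈ ψ.dom) : dx E'.f (ψ.base q) = 0 ∧
      (deriv E'.lam (ψ.base q).1 = 0 → dt E'.f (ψ.base q) = 0) := by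
  obtain ⟨c, l, hc, hl, hE⟩ := hconst.exists_coeffs
  obtain ⟨hMx, hMt⟩ := h.pd_pullbackM_eq_zero hl hc hE hq
  obtain ⟨hTt, hXx, -⟩ := h.ne_zero hl hc hE hq
  have hTx := (h.pd_T_eq_zero hl hc hE hq).1
  have hm := h.2.1 q hq
  have hne := E'.ne_zero _ hm
  have hlam : E'.lam (ψ.T q) ≠ 0 := right_ne_zero_of_mul hne
  have hfd := differentiableAt_of_contDiffOn E'.isOpen_D E'.smooth_f hm
  have hN (e : ℝ × ℝ × ℝ) (he : pd e (pullbackM ψ E') q = 0) :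
      deriv E'.lam (ψ.T q) * pd e ψ.T q * E'.f (ψ.base q) + E'.lam (ψ.T q)
        * (pd e ψ.T q * pd (1, 0) E'.f (ψ.base q)
          + pd e ψ.X q * pd (0, 1) E'.f (ψ.base q)) = 0 := by
    have h0 : q + (0 : ℝ) • e = q := by simp
    have hne' : E'.lam (ψ.T (q + (0 : ℝ) • e)) * E'.f (ψ.base (q + (0 : ℝ) • e)) ≠ 0 := by
      rw [h0, mul_comm]
      exact hne
    have h1 := (h.hasDerivAt_inv_pullbackM hq e).inv hne'
    have h2 := hasDerivAt_pd ψ.isOpen_dom h.contDiffOn_pullbackM hq e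
    have h3 := h1.unique h2
    rw [he, div_eq_zero_iff] at h3
    rcases h3 with h3 | h3
    · linarith
    · exact absurd h3 (pow_ne_zero 2 hne')
  have hfx : pd (0, 1) E'.f (ψ.base q) = 0 := by
    have := hN (0, 1, 0) hMx
    rw [hTx] at this
    have h2 : (E'.lam (ψ.T q) * pd (0, 1, 0) ψ.X q) * pd (0, 1) E'.f (ψ.base q) = 0 := by
      linarith
    exact (mul_eq_zero.1 h2).resolve_left (mul_ne_zero hlam hXx)
  refine ⟨by rw [dx_eq_pd hfd, hfx], fun hd => ?_⟩
  have := hN (1, 0, 0) hMt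
  rw [hfx, show deriv E'.lam (ψ.T q) = 0 from hd] at this
  have h2 : (E'.lam (ψ.T q) * pd (1, 0, 0) ψ.T q) * pd (1, 0) E'.f (ψ.base q) = 0 := by
    linarith
  rw [dt_eq_pd hfd]
  exact (mul_eq_zero.1 h2).resolve_left (mul_ne_zero hlam hTt)

end

theorem PotEq.fConst_of_derivatives {E : PotEq} (hx : ∀ p ∈ E.D, dx E.f p = 0)
    (ht : ∀ p ∈ E.D, deriv E.lam p.1 = 0 → dt E.f p = 0) : E.FConst := by
  have hxx : ∀ p ∈ E.D, dx (dx E.f) p = 0 := by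
    intro p hp
    have : (fun y => dx E.f (p.1, y)) =ᶠ[𝓝 p.2] fun _ => 0 := by
      filter_upwards [eventually_slice_mem E.isOpen_D hp] with y hy using hx _ hy
    rw [dx, this.deriv_eq, deriv_const]
  obtain ⟨p₀, hp₀⟩ := E.isConnected_D.nonempty
  refine ⟨E.f p₀, fun p hp => E.isOpen_D.is_const_of_fderiv_eq_zero
    E.isConnected_D.isPreconnected (E.smooth_f.differentiableOn (by simp)) ?_ hp hp₀⟩
  intro r hr
  have hd := differentiableAt_of_contDiffOn E.isOpen_D E.smooth_f hr
  have h1 : pd (0, 1) E.f r = 0 := by rw [← dx_eq_pd hd, hx r hr]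
  have h2 : pd (1, 0) E.f r = 0 := by
    rw [← dt_eq_pd hd]
    exact ht r hr (by rw [E.lam_t r hr, hxx r hr, zero_mul])
  ext
  · exact h2
  · exact h1

end PotentialBurgers

theorem mainTheorem11 (E₁ E₂ : PotentialBurgers.PotEq)
    (h₁ : E₁ ∈ PotentialBurgers.P1) (h₂ : E₂ ∈ PotentialBurgers.P2)
    (φ : PotentialBurgers.PointTransformation) :
    ¬ φ.MapsTo E₁ E₂ ∧ ¬ φ.MapsTo E₂ E₁ := by
  constructor
  · intro h
    have key : ∀ p ∈ E₂.D, PotentialBurgers.dx E₂.f p = 0 ∧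
        (deriv E₂.lam p.1 = 0 → PotentialBurgers.dt E₂.f p = 0) := by
      intro p hp
      rw [← h.2.1] at hp
      obtain ⟨_, ⟨q, hq, rfl⟩, rfl⟩ := hp
      exact h.carries.target_derivatives h₁ hq
    exact h₂ (PotentialBurgers.PotEq.fConst_of_derivatives (fun p hp => (key p hp).1)
      fun p hp => (key p hp).2)
  · intro h
    have key : ∀ p ∈ E₂.D, PotentialBurgers.dx E₂.f p = 0 ∧
        (deriv E₂.lam p.1 = 0 → PotentialBurgers.dt E₂.f p = 0) := by
      intro p hp
      rw [← h.1] at hp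
      obtain ⟨q, hq, rfl⟩ := hp
      obtain ⟨ψ, hmem, hinv, hcarr⟩ := h.exists_inverse hq
      have hb : ψ.base (φ.map q) = PotentialBurgers.proj q :=
        congrArg PotentialBurgers.proj hinv
      rw [← hb]
      exact hcarr.target_derivatives h₁ hmem
    exact h₂ (PotentialBurgers.PotEq.fConst_of_derivatives (fun p hp => (key p hp).1)
      fun p hp => (key p hp).2)
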